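/- Consider the $2\times 2$ MIMO X network with constant complex channel coefficients, in which transmitter $t\in\{1,2\}$ has $M_t$ antennas, receiver $r\in\{1,2\}$ has $N_r$ antennas, and transmitter $t$ has an independent message vector $\mathbf m_{rt}\in\mathbb R^{Q'_{rt}}$ for each receiver $r$. Receiver $r$ observes $\mathbf y_r=\sum_t \mathbf H_{rt}\mathbf x_t+\mathbf z_r$, where $\mathbf H_{rt}\in\mathbb C^{N_r\times M_t}$ is known to all nodes and the noise $\mathbf z_r$ has i.i.d. $\mathcal{CN}(0,1)$ entries, also across channel uses. All entries of the $\mathbf H_{rt}$ are independent, and those of each $\mathbf H_{rt}$ are identically distributed with a non-degenerate complex Gaussian law. Suppose $$N_1\ge N_2\ge M_1\ge M_2,\qquad N_1+N_2\le 3M_2 ,$$ and let $x'=3M_2-N_1-N_2$. Put $$Q'_{11}=Q'_{12}=2(N_1-M_2)+\Big\lfloor\frac{2x'}3\Big\rfloor,\quad Q'_{21}=N_2+M_2-N_1-\Big\lceil\frac{x'-1}3\Big\rceil,\quad Q'_{22}=N_2+M_2-N_1-\Big\lfloor\frac{x'}3\Big\rfloor .$$ These are non-negative integers, and they are all positive if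 $M_1>1$ and $N_1+N_2\ne 2M_1+M_2$. For almost every channel realization there are precoding vectors in $\mathbb C^{M_t}$, one for each entry of each $\mathbf m_{rt}$ and not depending on the power, such that: (a) for each $r$, the first $\min(Q'_{r1},Q'_{r2})$ entries of $\mathbf m_{r1}$ and of $\mathbf m_{r2}$ are aligned in pairs, that is, received along the same direction, at the other receiver; and at each receiver the directions of all desired entries together with all distinct interference directions are linearly independent over $\mathbb R$; (b) when the entries of the message vectors are encoded separately into real codewords and sent with these precoding vectors, every entry achieves $\frac12$ degree of freedom: for every power constraint $\rho>0$ on the transmitters there are rates $R(\rho)$ of the entries, achievable simultaneously with error probability tending to $0$ as the block length tends to infinity, such that $R(\rho)/\log_2\rho\to\frac12$ for every entry as $\rho\to\infty$. Consequently the total achieved DoF is $$\frac{Q'_{11}+Q'_{12}+Q'_{21}+Q'_{22}}2=N_1+N_2-M_2+\frac12\Big\lfloor\frac{2x'}3\Big\rfloor=\begin{cases}\dfrac{2(N_1+N_2)}3 & \text{if } x'\bmod 3=0,\\[2mm] \dfrac{2(N_1+N_2)-1}3 & \text{if } x'\bmod 3=1,\\[2mm] \dfrac{4(N_1+N_2)-1}6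 & \text{if } x'\bmod 3=2.\end{cases}$$ -/

import Mathlib

open MeasureTheory ProbabilityTheory Filter Topology Matrix
open scoped NNReal ENNReal

noncomputable section

namespace MIMOX

/-- The complex Gaussian distribution `𝒞𝒩(m, v)`: independent real and imaginary parts, each real
Gaussian with variance `v / 2`. -/
def complexGaussian (m : ℂ) (v : ℝ≥0) : Measure ℂ :=
  ((gaussianReal m.re (v / 2)).prod (gaussianReal m.im (v / 2))).map
    Complex.measurableEquivRealProd.symm

/-- Constant channel coefficients of the `2 × 2` MIMO X network in which transmitter `t` has `M t`
antennas and receiver `r` has `N r` antennas: `H r t i j` is the gain from the `j`-th antenna of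
transmitter `t` to the `i`-th antenna of receiver `r`. -/
abbrev Channel (M N : Fin 2 → ℕ) : Type :=
  ∀ r t : Fin 2, Fin (N r) → Fin (M t) → ℂ

/-- The channel matrix from transmitter `t` to receiver `r`. -/
def Channel.mat {M N : Fin 2 → ℕ} (H : Channel M N) (r t : Fin 2) :
    Matrix (Fin (N r)) (Fin (M t)) ℂ :=
  Matrix.of (H r t)

/-- The law of the channel: all entries of all four matrices are independent, and the entries of
the matrix from transmitter `t` to receiver `r` are distributed as `𝒞𝒩(m r t, v r t)`. -/
def channelLaw (M N : Fin 2 → ℕ) (m : Fin 2 → Fin 2 → ℂ) (v : Fin 2 → Fin 2 → ℝ≥0) :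
    Measure (Channel M N) :=
  Measure.pi fun r => Measure.pi fun t => Measure.pi fun _ : Fin (N r) =>
    Measure.pi fun _ : Fin (M t) => complexGaussian (m r t) (v r t)

/-- Precoding vectors: the message vector intended for receiver `r` at transmitter `t` has
`Q r t` real entries, and its `i`-th entry is precoded with the complex vector `V r t i`. -/
abbrev Precoders (M : Fin 2 → ℕ) (Q : Fin 2 → Fin 2 → ℕ) : Type :=
  ∀ r t : Fin 2, Fin (Q r t) → Fin (M t) → ℂ

section Scheme

variable {M N : Fin 2 → ℕ} {Q : Fin 2 → Fin 2 → ℕ}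

/-- One-to-one alignment in real space: of the streams intended for the other receiver `r.rev`,
the first `a r.rev` ones of transmitter `0` are received at receiver `r` along the same directions
as the first `a r.rev` ones of transmitter `1`. -/
def AlignedAt (H : Channel M N) (V : Precoders M Q) (a : Fin 2 → ℕ) (r : Fin 2) : Prop :=
  ∀ (i : ℕ) (_ : i < a r.rev) (h₀ : i < Q r.rev 0) (h₁ : i < Q r.rev 1),
    H.mat r 0 *ᵥ V r.rev 0 ⟨i, h₀⟩ = H.mat r 1 *ᵥ V r.rev 1 ⟨i, h₁⟩

/-- The distinct signal directions seen by receiver `r`: those of all desired streams, those of the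
interfering streams of transmitter `0`, and those of the interfering streams of transmitter `1`
that are not aligned with streams of transmitter `0`. -/
def receivedDirections (H : Channel M N) (V : Precoders M Q) (a : Fin 2 → ℕ) (r : Fin 2) :
    ((Σ t : Fin 2, Fin (Q r t)) ⊕
      (Fin (Q r.rev 0) ⊕ {i : Fin (Q r.rev 1) // a r.rev ≤ (i : ℕ)})) → (Fin (N r) → ℂ) :=
  Sum.elim (fun s => H.mat r s.1 *ᵥ V r s.1 s.2)
    (Sum.elim (fun i => H.mat r 0 *ᵥ V r.rev 0 i) (fun i => H.mat r 1 *ᵥ V r.rev 1 i.1))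

/-- The precoders `V` form an interference alignment scheme over the channel `H` in which
`a r` pairs of the streams intended for receiver `r` are aligned at the other receiver: at each
receiver, the distinct signal directions are linearly independent over the real numbers. -/
structure IsAlignmentScheme (H : Channel M N) (V : Precoders M Q) (a : Fin 2 → ℕ) : Prop where
  le_length : ∀ r t, a r ≤ Q r t
  aligned : ∀ r, AlignedAt H V a r
  independent : ∀ r, LinearIndependent ℝ (receivedDirections H V a r)

end Scheme

/-- A code for `n` channel uses, for receivers with `N r` antennas. Each of the `Q r t` message
streams from transmitter `t` to receiver `r` is encoded separately: stream `i` has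
`size r t i` messages, and `book r t i w` is the real codeword of message `w`. Receiver `r` decodes
all of its streams from the signals received during the `n` uses. -/
structure Code (N : Fin 2 → ℕ) (Q : Fin 2 → Fin 2 → ℕ) (n : ℕ) where
  size : ∀ r t : Fin 2, Fin (Q r t) → ℕ
  book : ∀ (r t : Fin 2) (i : Fin (Q r t)), Fin (size r t i) → Fin n → ℝ
  dec : ∀ r : Fin 2, (Fin n → Fin (N r) → ℂ) → ∀ (t : Fin 2) (i : Fin (Q r t)), Fin (size r t i)
  measurable_dec : ∀ r, Measurable (dec r)

namespace Code

variable {M N : Fin 2 → ℕ} {Q : Fin 2 → Fin 2 → ℕ} {n : ℕ}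

/-- A choice of one message for every stream. -/
abbrev Messages (C : Code N Q n) : Type :=
  ∀ (r t : Fin 2) (i : Fin (Q r t)), Fin (C.size r t i)

/-- The signal sent by transmitter `t` in channel use `k`. -/
def sent (C : Code N Q n) (V : Precoders M Q) (w : C.Messages) (t : Fin 2) (k : Fin n) :
    Fin (M t) → ℂ :=
  ∑ r : Fin 2, ∑ i : Fin (Q r t), C.book r t i (w r t i) k • V r t i

/-- The signal received by receiver `r`, when the noise there is `z`. -/
def received (C : Code N Q n) (H : Channel M N) (V : Precoders M Q) (w : C.Messages) (r : Fin 2)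
    (z : Fin n → Fin (N r) → ℂ) : Fin n → Fin (N r) → ℂ :=
  fun k => (∑ t : Fin 2, H.mat r t *ᵥ C.sent V w t k) + z k

/-- The average transmit power of each transmitter is at most `ρ`, whatever the messages are. -/
def PowerLE (C : Code N Q n) (V : Precoders M Q) (ρ : ℝ) : Prop :=
  ∀ (w : C.Messages) (t : Fin 2), ∑ k : Fin n, ∑ j : Fin (M t), ‖C.sent V w t k j‖ ^ 2 ≤ n * ρ

/-- The law of the noise at a receiver with `N` antennas during `n` channel uses: independent
`𝒞𝒩(0, 1)` entries. -/
def noiseLaw (n N : ℕ) : Measure (Fin n → Fin N → ℂ) :=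
  Measure.pi fun _ => Measure.pi fun _ => complexGaussian 0 1

/-- The probability that receiver `r` decodes one of its streams incorrectly when the messages `w`
are sent. -/
def errorProb (C : Code N Q n) (H : Channel M N) (V : Precoders M Q) (w : C.Messages)
    (r : Fin 2) : ℝ≥0∞ :=
  noiseLaw n (N r) {z | C.dec r (C.received H V w r z) ≠ w r}

end Code

section DoF

variable {M N : Fin 2 → ℕ} {Q : Fin 2 → Fin 2 → ℕ}

/-- The rates `R r t i` (in bits per channel use) of the streams are achievable with precoders `V`
under the power constraint `ρ`: for all large block lengths there are codes with at least
`2 ^ (n R)` messages per stream and arbitrarily small maximal probability of error. -/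
def RatesAchievable (H : Channel M N) (V : Precoders M Q) (ρ : ℝ)
    (R : ∀ r t : Fin 2, Fin (Q r t) → ℝ) : Prop :=
  ∀ ε : ℝ, 0 < ε → ∀ᶠ n : ℕ in atTop, ∃ C : Code N Q n,
    (∀ r t i, (2 : ℝ) ^ ((n : ℝ) * R r t i) ≤ (C.size r t i : ℝ)) ∧
    C.PowerLE V ρ ∧
    ∀ w r, C.errorProb H V w r ≤ ENNReal.ofReal ε

/-- The streams achieve the degrees of freedom `d r t i` with precoders `V`: there are rates
`R ρ r t i`, achievable under every power constraint `ρ`, with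
`R ρ r t i / log₂ ρ → d r t i` as `ρ → ∞`. -/
def DoFAchievable (H : Channel M N) (V : Precoders M Q) (d : ∀ r t : Fin 2, Fin (Q r t) → ℝ) :
    Prop :=
  ∃ R : ℝ → ∀ r t : Fin 2, Fin (Q r t) → ℝ,
    (∀ ρ : ℝ, 0 < ρ → RatesAchievable H V ρ (R ρ)) ∧
    ∀ r t i, Tendsto (fun ρ : ℝ => R ρ r t i / Real.logb 2 ρ) atTop (𝓝 (d r t i))

/-- The total degrees of freedom of all streams. -/
def totalDoF (d : ∀ r t : Fin 2, Fin (Q r t) → ℝ) : ℝ :=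
  ∑ r : Fin 2, ∑ t : Fin 2, ∑ i : Fin (Q r t), d r t i

end DoF

end MIMOX

end

/-! The argument has three parts.

Reduction to one channel: an aligned pair is a solution of `A x₀ = B x₁`, with `A`, `B` the two
channel matrices into the unintended receiver. If `(x₀, x₁) ↦ A x₀ - B x₁` is onto for a reference
channel, `solFst` and `solSnd` extend a solution there to one depending polynomially on the channel
and aligned for every channel. Independence of the received directions follows from the nonvanishing
of a real determinant that is analytic in the channel and nonzero at the reference
(`exists_analytic_linearIndependent`). Such a function is almost everywhere nonzero under a
non-degenerate Gaussian law (`analyticNull_channelLaw`), so one good channel yields almost all of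
them (`ae_exists_isScheme`).

The reference channel: schemes add up along block-diagonal channels, so it suffices to solve a few
tiny networks by hand and to count how many copies give the required parameters
(`exists_hasScheme`). Each receive antenna has two real dimensions; using them separately gives the
remainders modulo 3.

Rates: independence gives, for each desired stream, a real functional that returns this stream and
kills all others (`exists_zeroForcing`). What remains is a real scalar channel with noise of fixed
size. Integer codewords with about `√ρ` levels and `ℓ¹` distance proportional to the block length
exist by a Gilbert–Varshamov argument (`exists_code_words`). A Chernoff bound makes the error
exponentially small, at a rate loss independent of `ρ`; hence `1 / 2` degree of freedom per stream.
-/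

namespace MIMOX

/-! ### Zero sets of analytic functions under product measures -/

/-- Real analytic functions that do not vanish identically are almost everywhere nonzero. -/
def AnalyticNull {E : Type*} [NormedAddCommGroup E] [NormedSpace ℝ E] [MeasurableSpace E]
    (μ : Measure E) : Prop :=
  ∀ f : E → ℝ, AnalyticOnNhd ℝ f Set.univ → (∃ x, f x ≠ 0) → ∀ᵐ x ∂μ, f x ≠ 0

namespace AnalyticNull

/-- By the identity theorem the zeros are isolated, hence countable in `ℝ`, and a measure without
atoms ignores them. -/
theorem of_nullSingletonClass (μ : Measure ℝ) [NullSingletonClass μ] : AnalyticNull μ := by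
  rintro f hf ⟨x₀, hx₀⟩
  rcases hf.eqOn_zero_or_eventually_ne_zero_of_preconnected isPreconnected_univ with h | h
  · exact absurd (h (Set.mem_univ x₀)) hx₀
  · have hd : IsDiscrete {x | f x ≠ 0}ᶜ := by
      have := isDiscrete_of_codiscreteWithin (U := Set.univ) (s := {x | f x ≠ 0}ᶜ)
        (by rw [compl_compl]; exact h)
      simpa using this
    have hc : ({x | f x ≠ 0}ᶜ).Countable :=
      (HereditarilyLindelofSpace.isLindelof _).countable_of_isDiscrete hd
    exact hc.measure_zero μ

variable {E F : Type*} [NormedAddCommGroup E] [NormedSpace ℝ E] [MeasurableSpace E] [BorelSpace E]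
  [NormedAddCommGroup F] [NormedSpace ℝ F] [MeasurableSpace F] [BorelSpace F]

/-- Fubini: the slice through a nonzero value shows that, for almost every `x`, the function `f (x,
·)` is not identically zero. -/
theorem prod [SecondCountableTopology E] [SecondCountableTopology F] {μ : Measure E}
    {ν : Measure F} [SFinite μ] [SFinite ν] (hμ : AnalyticNull μ) (hν : AnalyticNull ν) :
    AnalyticNull (μ.prod ν) := by
  rintro f hf ⟨⟨x₀, y₀⟩, h₀⟩
  have hfc : Continuous f := continuousOn_univ.1 hf.continuousOn
  have hm : MeasurableSet {z : E × F | f z ≠ 0} := hfc.measurable (measurableSet_singleton 0).compl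
  rw [Measure.ae_prod_iff_ae_ae hm]
  have h1 : ∀ᵐ x ∂μ, f (x, y₀) ≠ 0 :=
    hμ (fun x => f (x, y₀)) (fun x _ => (hf (x, y₀) trivial).comp₂ analyticAt_id analyticAt_const)
      ⟨x₀, h₀⟩
  filter_upwards [h1] with x hx
  exact hν (fun y => f (x, y)) (fun y _ => (hf (x, y) trivial).comp₂ analyticAt_const analyticAt_id)
    ⟨y₀, hx⟩

theorem map {μ : Measure E} (hμ : AnalyticNull μ) (e : E ≃L[ℝ] F) : AnalyticNull (μ.map e) := by
  rintro f hf ⟨y₀, h₀⟩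
  have hfc : Continuous f := continuousOn_univ.1 hf.continuousOn
  have hm : MeasurableSet {z : F | f z ≠ 0} := hfc.measurable (measurableSet_singleton 0).compl
  rw [ae_map_iff e.continuous.measurable.aemeasurable hm]
  exact hμ (fun x => f (e x))
    (fun x _ => (hf (e x) trivial).comp ((e : E →L[ℝ] F).analyticAt x)) ⟨e.symm y₀, by simpa⟩

/-- Splitting off the first coordinate, as a continuous linear equivalence. -/
noncomputable def consEquiv {n : ℕ} (X : Fin (n + 1) → Type*) [∀ i, NormedAddCommGroup (X i)]
    [∀ i, NormedSpace ℝ (X i)] : (X 0 × ∀ i : Fin n, X i.succ) ≃L[ℝ] ∀ i, X i where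
  toFun p := Fin.cons p.1 p.2
  invFun f := (f 0, fun i => f i.succ)
  left_inv p := by simp
  right_inv f := Fin.cons_self_tail f
  map_add' p q := by
    ext i
    refine Fin.cases ?_ (fun j => ?_) i <;> simp
  map_smul' c p := by
    ext i
    refine Fin.cases ?_ (fun j => ?_) i <;> simp
  continuous_toFun := by
    refine continuous_pi fun i => ?_
    refine Fin.cases ?_ (fun j => ?_) i
    · simpa using continuous_fst
    · simpa [Function.comp_def] using (continuous_apply j).comp continuous_snd
  continuous_invFun := by fun_prop

theorem pi {n : ℕ} {X : Fin n → Type*} [∀ i, NormedAddCommGroup (X i)] [∀ i, NormedSpace ℝ (X i)]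
    [∀ i, MeasurableSpace (X i)] [∀ i, BorelSpace (X i)] [∀ i, SecondCountableTopology (X i)]
    {μ : ∀ i, Measure (X i)} [∀ i, SigmaFinite (μ i)] (h : ∀ i, AnalyticNull (μ i)) :
    AnalyticNull (Measure.pi μ) := by
  induction n with
  | zero =>
    rintro f - ⟨x₀, h₀⟩
    exact ae_of_all _ fun x => by rwa [Subsingleton.elim x x₀]
  | succ n ih =>
    have h1 : AnalyticNull ((μ 0).prod (Measure.pi fun i : Fin n => μ i.succ)) :=
      (h 0).prod (ih fun i => h i.succ)
    have h2 := h1.map (consEquiv X)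
    have h3 := ((measurePreserving_piFinSuccAbove μ 0).symm).map_eq
    -- One map seen twice: `consEquiv` carries analyticity, `piFinSuccAbove` carries the product
    -- measure.
    have h4 : (⇑(consEquiv X)) = ⇑(MeasurableEquiv.piFinSuccAbove X 0).symm := by
      funext p
      funext i
      refine Fin.cases ?_ (fun j => ?_) i
      · exact (Fin.insertNth_apply_same (α := X) 0 p.1 p.2).symm
      · exact (Fin.insertNth_apply_succAbove (α := X) 0 p.1 p.2 j).symm
    rw [h4] at h2
    exact h3 ▸ h2

end AnalyticNull

instance (m : ℂ) (v : ℝ≥0) : IsProbabilityMeasure (complexGaussian m v) :=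
  Measure.isProbabilityMeasure_map Complex.measurableEquivRealProd.symm.measurable.aemeasurable

theorem analyticNull_complexGaussian (m : ℂ) {v : ℝ≥0} (hv : v ≠ 0) :
    AnalyticNull (complexGaussian m v) := by
  have hv2 : v / 2 ≠ 0 := by simpa using hv
  have := nullSingletonClass_gaussianReal (μ := m.re) hv2
  have := nullSingletonClass_gaussianReal (μ := m.im) hv2
  exact ((AnalyticNull.of_nullSingletonClass (gaussianReal m.re (v / 2))).prod
    (AnalyticNull.of_nullSingletonClass (gaussianReal m.im (v / 2)))).map Complex.equivRealProdCLM.symm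

theorem analyticNull_channelLaw {M N : Fin 2 → ℕ} (m : Fin 2 → Fin 2 → ℂ)
    {v : Fin 2 → Fin 2 → ℝ≥0} (hv : ∀ r t, v r t ≠ 0) : AnalyticNull (channelLaw M N m v) :=
  .pi fun r => .pi fun t => .pi fun _ => .pi fun _ => analyticNull_complexGaussian (m r t) (hv r t)

/-! ### Alignment schemes and their direct sums -/

/-- Four families of vectors, combined into one. -/
def quad {α β γ δ E : Type*} (a : α → E) (b : β → E) (c : γ → E) (d : δ → E) :
    (α ⊕ β) ⊕ (γ ⊕ δ) → E :=
  Sum.elim (Sum.elim a b) (Sum.elim c d)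

/-- One-to-one alignment over `Matrix`-valued channels with arbitrary index types: the streams `u`
are desired at the first receiver and aligned at the second one, the streams `w` conversely, and
the streams `f` of the second transmitter are desired at the second receiver and not aligned. -/
structure IsScheme {μ₀ μ₁ ν₀ ν₁ α β ε : Type*} [Fintype μ₀] [Fintype μ₁]
    (H₀₀ : Matrix ν₀ μ₀ ℂ) (H₀₁ : Matrix ν₀ μ₁ ℂ) (H₁₀ : Matrix ν₁ μ₀ ℂ) (H₁₁ : Matrix ν₁ μ₁ ℂ)
    (u₀ : α → μ₀ → ℂ) (u₁ : α → μ₁ → ℂ) (w₀ : β → μ₀ → ℂ) (w₁ : β → μ₁ → ℂ) (f : ε → μ₁ → ℂ) :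
    Prop where
  align₀ : ∀ i, H₀₀ *ᵥ w₀ i = H₀₁ *ᵥ w₁ i
  align₁ : ∀ i, H₁₀ *ᵥ u₀ i = H₁₁ *ᵥ u₁ i
  indep₀ : LinearIndependent ℝ (quad (fun i => H₀₀ *ᵥ u₀ i) (fun i => H₀₁ *ᵥ u₁ i)
    (fun i => H₀₀ *ᵥ w₀ i) (fun i => H₀₁ *ᵥ f i))
  indep₁ : LinearIndependent ℝ (quad (fun i => H₁₀ *ᵥ w₀ i) (fun i => H₁₁ *ᵥ w₁ i)
    (fun i => H₁₁ *ᵥ f i) (fun i => H₁₀ *ᵥ u₀ i))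

/-- There is a channel with prescribed numbers of antennas and an alignment scheme with prescribed
numbers of streams over it, such that the two matrices that describe alignment have full rank. -/
def HasScheme (m₀ m₁ n₀ n₁ a b e : ℕ) : Prop :=
  ∃ (H₀₀ : Matrix (Fin n₀) (Fin m₀) ℂ) (H₀₁ : Matrix (Fin n₀) (Fin m₁) ℂ)
    (H₁₀ : Matrix (Fin n₁) (Fin m₀) ℂ) (H₁₁ : Matrix (Fin n₁) (Fin m₁) ℂ)
    (u₀ : Fin a → Fin m₀ → ℂ) (u₁ : Fin a → Fin m₁ → ℂ) (w₀ : Fin b → Fin m₀ → ℂ)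
    (w₁ : Fin b → Fin m₁ → ℂ) (f : Fin e → Fin m₁ → ℂ),
    (∀ y, ∃ x₀ x₁, H₀₀ *ᵥ x₀ - H₀₁ *ᵥ x₁ = y) ∧ (∀ y, ∃ x₀ x₁, H₁₀ *ᵥ x₀ - H₁₁ *ᵥ x₁ = y) ∧
    IsScheme H₀₀ H₀₁ H₁₀ H₁₁ u₀ u₁ w₀ w₁ f

theorem linearIndependent_congr {ι E : Type*} [AddCommGroup E] [Module ℝ E] {v w : ι → E}
    (h : LinearIndependent ℝ v) (hw : ∀ i, w i = v i) : LinearIndependent ℝ w := by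
  rwa [funext hw]

theorem linearIndependent_direct_sum {ι ι' ν ν' : Type*} {v : ι → ν → ℂ} {v' : ι' → ν' → ℂ}
    (h : LinearIndependent ℝ v) (h' : LinearIndependent ℝ v') :
    LinearIndependent ℝ (Sum.elim (fun i => (Sum.elim (v i) 0 : ν ⊕ ν' → ℂ))
      (fun i => Sum.elim 0 (v' i))) := by
  have h1 := linearIndependent_inl_union_inr' h h'
  have h2 := h1.map' (LinearEquiv.sumArrowLequivProdArrow ν ν' ℝ ℂ).symm.toLinearMap
    (LinearEquiv.ker _)
  refine linearIndependent_congr h2 fun i => ?_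
  rcases i with i | i <;> ext j <;> rcases j with j | j <;> simp

theorem linearIndependent_quad_direct_sum {α β γ δ α' β' γ' δ' ν ν' : Type*}
    {a : α → ν → ℂ} {b : β → ν → ℂ} {c : γ → ν → ℂ} {d : δ → ν → ℂ}
    {a' : α' → ν' → ℂ} {b' : β' → ν' → ℂ} {c' : γ' → ν' → ℂ} {d' : δ' → ν' → ℂ}
    (h : LinearIndependent ℝ (quad a b c d)) (h' : LinearIndependent ℝ (quad a' b' c' d')) :
    LinearIndependent ℝ (quad
      (Sum.elim (fun i => (Sum.elim (a i) 0 : ν ⊕ ν' → ℂ)) (fun i => Sum.elim 0 (a' i)))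
      (Sum.elim (fun i => (Sum.elim (b i) 0 : ν ⊕ ν' → ℂ)) (fun i => Sum.elim 0 (b' i)))
      (Sum.elim (fun i => (Sum.elim (c i) 0 : ν ⊕ ν' → ℂ)) (fun i => Sum.elim 0 (c' i)))
      (Sum.elim (fun i => (Sum.elim (d i) 0 : ν ⊕ ν' → ℂ)) (fun i => Sum.elim 0 (d' i)))) := by
  have h1 := (linearIndependent_direct_sum h h').comp _
    (((Equiv.sumSumSumComm α α' β β').sumCongr (Equiv.sumSumSumComm γ γ' δ δ')).trans
      (Equiv.sumSumSumComm (α ⊕ β) (α' ⊕ β') (γ ⊕ δ) (γ' ⊕ δ'))).injective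
  refine linearIndependent_congr h1 fun i => ?_
  rcases i with ((i | i) | (i | i)) | ((i | i) | (i | i)) <;> simp [quad]

section Blocks

variable {μ μ' ν ν' : Type*} [Fintype μ] [Fintype μ'] (A : Matrix ν μ ℂ) (B : Matrix ν' μ' ℂ)

theorem fromBlocks_mulVec_inl (x : μ → ℂ) :
    fromBlocks A 0 0 B *ᵥ Sum.elim x 0 = Sum.elim (A *ᵥ x) 0 := by
  rw [fromBlocks_mulVec]; simp

theorem fromBlocks_mulVec_inr (x : μ' → ℂ) :
    fromBlocks A 0 0 B *ᵥ Sum.elim 0 x = Sum.elim (0 : ν → ℂ) (B *ᵥ x) := by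
  rw [fromBlocks_mulVec]; simp

theorem fromBlocks_mulVec_family {ι ι' : Type*} (u : ι → μ → ℂ) (u' : ι' → μ' → ℂ) :
    (fun i => fromBlocks A 0 0 B *ᵥ
      (Sum.elim (fun i => (Sum.elim (u i) 0 : μ ⊕ μ' → ℂ)) (fun i => Sum.elim 0 (u' i)) i)) =
    Sum.elim (fun i => (Sum.elim (A *ᵥ u i) 0 : ν ⊕ ν' → ℂ)) (fun i => Sum.elim 0 (B *ᵥ u' i)) := by
  funext i
  rcases i with i | i
  · exact fromBlocks_mulVec_inl A B _
  · exact fromBlocks_mulVec_inr A B _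

end Blocks

/-- The direct sum of two alignment schemes. -/
theorem IsScheme.directSum {μ₀ μ₁ ν₀ ν₁ α β ε μ₀' μ₁' ν₀' ν₁' α' β' ε' : Type*} [Fintype μ₀]
    [Fintype μ₁] [Fintype μ₀'] [Fintype μ₁']
    {H₀₀ : Matrix ν₀ μ₀ ℂ} {H₀₁ : Matrix ν₀ μ₁ ℂ} {H₁₀ : Matrix ν₁ μ₀ ℂ} {H₁₁ : Matrix ν₁ μ₁ ℂ}
    {u₀ : α → μ₀ → ℂ} {u₁ : α → μ₁ → ℂ} {w₀ : β → μ₀ → ℂ} {w₁ : β → μ₁ → ℂ} {f : ε → μ₁ → ℂ}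
    {H₀₀' : Matrix ν₀' μ₀' ℂ} {H₀₁' : Matrix ν₀' μ₁' ℂ} {H₁₀' : Matrix ν₁' μ₀' ℂ}
    {H₁₁' : Matrix ν₁' μ₁' ℂ}
    {u₀' : α' → μ₀' → ℂ} {u₁' : α' → μ₁' → ℂ} {w₀' : β' → μ₀' → ℂ} {w₁' : β' → μ₁' → ℂ}
    {f' : ε' → μ₁' → ℂ}
    (h : IsScheme H₀₀ H₀₁ H₁₀ H₁₁ u₀ u₁ w₀ w₁ f)
    (h' : IsScheme H₀₀' H₀₁' H₁₀' H₁₁' u₀' u₁' w₀' w₁' f') :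
    IsScheme (fromBlocks H₀₀ 0 0 H₀₀') (fromBlocks H₀₁ 0 0 H₀₁') (fromBlocks H₁₀ 0 0 H₁₀')
      (fromBlocks H₁₁ 0 0 H₁₁')
      (Sum.elim (fun i => Sum.elim (u₀ i) 0) (fun i => Sum.elim 0 (u₀' i)))
      (Sum.elim (fun i => Sum.elim (u₁ i) 0) (fun i => Sum.elim 0 (u₁' i)))
      (Sum.elim (fun i => Sum.elim (w₀ i) 0) (fun i => Sum.elim 0 (w₀' i)))
      (Sum.elim (fun i => Sum.elim (w₁ i) 0) (fun i => Sum.elim 0 (w₁' i)))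
      (Sum.elim (fun i => Sum.elim (f i) 0) (fun i => Sum.elim 0 (f' i))) where
  align₀ i := by
    rcases i with i | i
    · simp only [Sum.elim_inl, fromBlocks_mulVec_inl, h.align₀]
    · simp only [Sum.elim_inr, fromBlocks_mulVec_inr, h'.align₀]
  align₁ i := by
    rcases i with i | i
    · simp only [Sum.elim_inl, fromBlocks_mulVec_inl, h.align₁]
    · simp only [Sum.elim_inr, fromBlocks_mulVec_inr, h'.align₁]
  indep₀ := by
    simp only [fromBlocks_mulVec_family]
    exact linearIndependent_quad_direct_sum h.indep₀ h'.indep₀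
  indep₁ := by
    simp only [fromBlocks_mulVec_family]
    exact linearIndependent_quad_direct_sum h.indep₁ h'.indep₁

section Reindex

variable {μ μ' ν ν' : Type*} [Fintype μ] [Fintype μ'] (e : μ ≃ μ') (g : ν ≃ ν')

theorem submatrix_mulVec_symm (A : Matrix ν μ ℂ) (x : μ → ℂ) :
    A.submatrix g.symm e.symm *ᵥ (x ∘ e.symm) = (A *ᵥ x) ∘ g.symm := by
  rw [submatrix_mulVec_equiv]
  simp [Function.comp_assoc]

theorem linearIndependent_quad_reindex {α β γ δ α' β' γ' δ' : Type*}
    {a : α → ν → ℂ} {b : β → ν → ℂ} {c : γ → ν → ℂ} {d : δ → ν → ℂ} (eα : α ≃ α') (eβ : β ≃ β')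
    (eγ : γ ≃ γ') (eδ : δ ≃ δ') (h : LinearIndependent ℝ (quad a b c d)) :
    LinearIndependent ℝ (quad (fun i => a (eα.symm i) ∘ g.symm) (fun i => b (eβ.symm i) ∘ g.symm)
      (fun i => c (eγ.symm i) ∘ g.symm) (fun i => d (eδ.symm i) ∘ g.symm)) := by
  have h1 := (h.map' (LinearEquiv.funCongrLeft ℝ ℂ g.symm).toLinearMap (LinearEquiv.ker _)).comp _
    ((eα.sumCongr eβ).sumCongr (eγ.sumCongr eδ)).symm.injective
  refine linearIndependent_congr h1 fun i => ?_
  rcases i with (i | i) | (i | i) <;> rfl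

end Reindex

/-- Transport of an alignment scheme along bijections of all index types. -/
theorem IsScheme.reindex {μ₀ μ₁ ν₀ ν₁ α β ε μ₀' μ₁' ν₀' ν₁' α' β' ε' : Type*} [Fintype μ₀]
    [Fintype μ₁] [Fintype μ₀'] [Fintype μ₁']
    {H₀₀ : Matrix ν₀ μ₀ ℂ} {H₀₁ : Matrix ν₀ μ₁ ℂ} {H₁₀ : Matrix ν₁ μ₀ ℂ} {H₁₁ : Matrix ν₁ μ₁ ℂ}
    {u₀ : α → μ₀ → ℂ} {u₁ : α → μ₁ → ℂ} {w₀ : β → μ₀ → ℂ} {w₁ : β → μ₁ → ℂ} {f : ε → μ₁ → ℂ}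
    (h : IsScheme H₀₀ H₀₁ H₁₀ H₁₁ u₀ u₁ w₀ w₁ f) (p₀ : μ₀ ≃ μ₀') (p₁ : μ₁ ≃ μ₁')
    (q₀ : ν₀ ≃ ν₀') (q₁ : ν₁ ≃ ν₁') (eα : α ≃ α') (eβ : β ≃ β') (eε : ε ≃ ε') :
    IsScheme (H₀₀.submatrix q₀.symm p₀.symm) (H₀₁.submatrix q₀.symm p₁.symm)
      (H₁₀.submatrix q₁.symm p₀.symm) (H₁₁.submatrix q₁.symm p₁.symm)
      (fun i => u₀ (eα.symm i) ∘ p₀.symm) (fun i => u₁ (eα.symm i) ∘ p₁.symm)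
      (fun i => w₀ (eβ.symm i) ∘ p₀.symm) (fun i => w₁ (eβ.symm i) ∘ p₁.symm)
      (fun i => f (eε.symm i) ∘ p₁.symm) where
  align₀ i := by simp only [submatrix_mulVec_symm, h.align₀]
  align₁ i := by simp only [submatrix_mulVec_symm, h.align₁]
  indep₀ := by
    simp only [submatrix_mulVec_symm]
    exact linearIndependent_quad_reindex q₀ (a := fun i => H₀₀ *ᵥ u₀ i) (b := fun i => H₀₁ *ᵥ u₁ i)
      (c := fun i => H₀₀ *ᵥ w₀ i) (d := fun i => H₀₁ *ᵥ f i) eα eα eβ eε h.indep₀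
  indep₁ := by
    simp only [submatrix_mulVec_symm]
    exact linearIndependent_quad_reindex q₁ (a := fun i => H₁₀ *ᵥ w₀ i) (b := fun i => H₁₁ *ᵥ w₁ i)
      (c := fun i => H₁₁ *ᵥ f i) (d := fun i => H₁₀ *ᵥ u₀ i) eβ eβ eε eα h.indep₁

theorem exists_fromBlocks_mulVec_sub {m₀ m₁ n m₀' m₁' n' : ℕ} {A : Matrix (Fin n) (Fin m₀) ℂ}
    {B : Matrix (Fin n) (Fin m₁) ℂ} {A' : Matrix (Fin n') (Fin m₀') ℂ}
    {B' : Matrix (Fin n') (Fin m₁') ℂ} (h : ∀ y, ∃ x₀ x₁, A *ᵥ x₀ - B *ᵥ x₁ = y)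
    (h' : ∀ y, ∃ x₀ x₁, A' *ᵥ x₀ - B' *ᵥ x₁ = y) (y : Fin (n + n') → ℂ) :
    ∃ x₀ x₁, (fromBlocks A 0 0 A').submatrix finSumFinEquiv.symm finSumFinEquiv.symm *ᵥ x₀ -
      (fromBlocks B 0 0 B').submatrix finSumFinEquiv.symm finSumFinEquiv.symm *ᵥ x₁ = y := by
  obtain ⟨x₀, x₁, hx⟩ := h fun i => y (finSumFinEquiv (Sum.inl i))
  obtain ⟨x₀', x₁', hx'⟩ := h' fun i => y (finSumFinEquiv (Sum.inr i))
  refine ⟨Sum.elim x₀ x₀' ∘ finSumFinEquiv.symm, Sum.elim x₁ x₁' ∘ finSumFinEquiv.symm, ?_⟩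
  rw [submatrix_mulVec_symm, submatrix_mulVec_symm, fromBlocks_mulVec, fromBlocks_mulVec]
  funext i
  obtain ⟨j, rfl⟩ := finSumFinEquiv.surjective i
  rcases j with j | j
  · simpa using congrFun hx j
  · simpa using congrFun hx' j

/-- Two networks side by side do not interact: all matrices are block diagonal, so alignment,
independence and surjectivity hold blockwise. -/
theorem HasScheme.add {m₀ m₁ n₀ n₁ a b e m₀' m₁' n₀' n₁' a' b' e' : ℕ}
    (h : HasScheme m₀ m₁ n₀ n₁ a b e) (h' : HasScheme m₀' m₁' n₀' n₁' a' b' e') :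
    HasScheme (m₀ + m₀') (m₁ + m₁') (n₀ + n₀') (n₁ + n₁') (a + a') (b + b') (e + e') := by
  obtain ⟨H₀₀, H₀₁, H₁₀, H₁₁, u₀, u₁, w₀, w₁, f, s₀, s₁, h⟩ := h
  obtain ⟨H₀₀', H₀₁', H₁₀', H₁₁', u₀', u₁', w₀', w₁', f', s₀', s₁', h'⟩ := h'
  exact ⟨_, _, _, _, _, _, _, _, _, exists_fromBlocks_mulVec_sub s₀ s₀',
    exists_fromBlocks_mulVec_sub s₁ s₁', (h.directSum h').reindex finSumFinEquiv finSumFinEquiv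
      finSumFinEquiv finSumFinEquiv finSumFinEquiv finSumFinEquiv finSumFinEquiv⟩

theorem hasScheme_zero : HasScheme 0 0 0 0 0 0 0 :=
  ⟨0, 0, 0, 0, 0, 0, 0, 0, 0, fun _ => ⟨0, 0, Subsingleton.elim _ _⟩,
    fun _ => ⟨0, 0, Subsingleton.elim _ _⟩,
    ⟨fun i => i.elim0, fun i => i.elim0, linearIndependent_empty_type, linearIndependent_empty_type⟩⟩

/-- An unused antenna at the first transmitter. -/
theorem hasScheme_extra_antenna : HasScheme 1 0 0 0 0 0 0 :=
  ⟨0, 0, 0, 0, 0, 0, 0, 0, 0, fun _ => ⟨0, 0, Subsingleton.elim _ _⟩,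
    fun _ => ⟨0, 0, Subsingleton.elim _ _⟩,
    ⟨fun i => i.elim0, fun i => i.elim0, linearIndependent_empty_type, linearIndependent_empty_type⟩⟩

theorem HasScheme.nsmul {m₀ m₁ n₀ n₁ a b e : ℕ} (h : HasScheme m₀ m₁ n₀ n₁ a b e) (k : ℕ) :
    HasScheme (k * m₀) (k * m₁) (k * n₀) (k * n₁) (k * a) (k * b) (k * e) := by
  induction k with
  | zero => simpa using hasScheme_zero
  | succ k ih => simpa only [Nat.succ_mul] using ih.add h

/-! ### Explicit small networks and their combination -/

/-- The two-antenna receiver separates the transmitters completely, while both gains to the other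
receiver are `1`, so equal precoders align. The real directions `1` and `I` carry one stream each.
-/
theorem hasScheme_first : HasScheme 1 1 2 1 2 0 0 := by
  refine ⟨!![1; 0], !![0; 1], !![1], !![1], ![![1], ![Complex.I]], ![![1], ![Complex.I]], ![], ![],
    ![], fun y => ⟨![y 0], ![-y 1], ?_⟩, fun y => ⟨![y 0], 0, ?_⟩, fun i => i.elim0, fun i => rfl,
    ?_, ?_⟩
  · ext i; fin_cases i <;> simp
  · ext i; fin_cases i; simp
  · rw [Fintype.linearIndependent_iff]
    intro g hg
    have h0 := congrFun hg 0
    have h1 := congrFun hg 1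
    simp [quad, Fin.sum_univ_succ, Complex.ext_iff] at h0 h1
    rintro ((i | i) | (i | i)) <;> fin_cases i <;> simp <;> linarith
  · rw [Fintype.linearIndependent_iff]
    intro g hg
    have h0 := congrFun hg 0
    simp [quad, Fin.sum_univ_succ, Complex.ext_iff] at h0
    rintro ((i | i) | (i | i)) <;> fin_cases i <;> simp <;> linarith

theorem hasScheme_second : HasScheme 1 1 1 2 0 2 0 := by
  refine ⟨!![1], !![1], !![1; 0], !![0; 1], ![], ![], ![![1], ![Complex.I]], ![![1], ![Complex.I]],
    ![], fun y => ⟨![y 0], 0, ?_⟩, fun y => ⟨![y 0], ![-y 1], ?_⟩, fun i => rfl, fun i => i.elim0,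
    ?_, ?_⟩
  · ext i; fin_cases i; simp
  · ext i; fin_cases i <;> simp
  · rw [Fintype.linearIndependent_iff]
    intro g hg
    have h0 := congrFun hg 0
    simp [quad, Fin.sum_univ_succ, Complex.ext_iff] at h0
    rintro ((i | i) | (i | i)) <;> fin_cases i <;> simp <;> linarith
  · rw [Fintype.linearIndependent_iff]
    intro g hg
    have h0 := congrFun hg 0
    have h1 := congrFun hg 1
    simp [quad, Fin.sum_univ_succ, Complex.ext_iff] at h0 h1
    rintro ((i | i) | (i | i)) <;> fin_cases i <;> simp <;> linarith

/-- A rotation by `I` on one cross link aligns `I` and `1` at the first receiver; at the second they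
remain independent over `ℝ`, though not over `ℂ`. -/
theorem hasScheme_one : HasScheme 1 1 1 1 0 1 0 := by
  refine ⟨1, !![Complex.I], 1, 1, ![], ![], ![![Complex.I]], ![![1]],
    ![], fun y => ⟨y, 0, by simp⟩, fun y => ⟨y, 0, by simp⟩, fun i => ?_, fun i => i.elim0,
    ?_, ?_⟩
  · ext j; fin_cases i; fin_cases j; simp
  · rw [Fintype.linearIndependent_iff]
    intro g hg
    have h0 := congrFun hg 0
    simp [quad, Complex.ext_iff] at h0
    rintro ((i | i) | (i | i)) <;> fin_cases i <;> simp <;> linarith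
  · rw [Fintype.linearIndependent_iff]
    intro g hg
    have h0 := congrFun hg 0
    simp [quad, Complex.ext_iff] at h0
    rintro ((i | i) | (i | i)) <;> fin_cases i <;> simp <;> linarith

/-- Both receivers are full: four real dimensions hold two desired and two interfering directions at
the first, three desired and one interfering at the second. -/
theorem hasScheme_two : HasScheme 2 2 2 2 1 1 1 := by
  refine ⟨1, !![Complex.I, Complex.I; 0, 1], 1, 1, ![![1, 0]], ![![1, 0]], ![![Complex.I, 1]],
    ![![0, 1]], ![![0, Complex.I]], fun y => ⟨y, 0, by simp⟩, fun y => ⟨y, 0, by simp⟩,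
    fun i => ?_, fun i => rfl, ?_, ?_⟩
  · ext j; fin_cases i; fin_cases j <;> simp
  · rw [Fintype.linearIndependent_iff]
    intro g hg
    have h0 := congrFun hg 0
    have h1 := congrFun hg 1
    simp [quad, Complex.ext_iff] at h0 h1
    rintro ((i | i) | (i | i)) <;> fin_cases i <;> simp <;> linarith
  · rw [Fintype.linearIndependent_iff]
    intro g hg
    have h0 := congrFun hg 0
    have h1 := congrFun hg 1
    simp [quad, Complex.ext_iff] at h0 h1
    rintro ((i | i) | (i | i)) <;> fin_cases i <;> simp <;> linarith

/-- Complex alignment: each receiver sees two desired complex lines and one interfering line, and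
each line carries the two real streams `1` and `I`. -/
theorem hasScheme_three : HasScheme 3 3 3 3 2 2 0 := by
  refine ⟨1, !![0, 1, 0; 1, 0, 1; 0, 0, 1], 1, 1, ![![1, 0, 0], ![Complex.I, 0, 0]],
    ![![1, 0, 0], ![Complex.I, 0, 0]], ![![0, 1, 1], ![0, Complex.I, Complex.I]],
    ![![0, 0, 1], ![0, 0, Complex.I]], ![], fun y => ⟨y, 0, by simp⟩, fun y => ⟨y, 0, by simp⟩,
    fun i => ?_, fun i => rfl, ?_, ?_⟩
  · ext j; fin_cases i <;> fin_cases j <;> simp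
  · rw [Fintype.linearIndependent_iff]
    intro g hg
    have h0 := congrFun hg 0
    have h1 := congrFun hg 1
    have h2 := congrFun hg 2
    simp [quad, Fin.sum_univ_succ, Complex.ext_iff] at h0 h1 h2
    rintro ((i | i) | (i | i)) <;> fin_cases i <;> simp <;> linarith
  · rw [Fintype.linearIndependent_iff]
    intro g hg
    have h0 := congrFun hg 0
    have h1 := congrFun hg 1
    have h2 := congrFun hg 2
    simp [quad, Fin.sum_univ_succ, Complex.ext_iff] at h0 h1 h2
    rintro ((i | i) | (i | i)) <;> fin_cases i <;> simp <;> linarith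

theorem hasScheme_of_eq {m₀ m₁ n₀ n₁ a b e m₀' m₁' n₀' n₁' a' b' e' : ℕ}
    (h : HasScheme m₀ m₁ n₀ n₁ a b e) (h₁ : m₀' = m₀) (h₂ : m₁' = m₁) (h₃ : n₀' = n₀)
    (h₄ : n₁' = n₁) (h₅ : a' = a) (h₆ : b' = b) (h₇ : e' = e) :
    HasScheme m₀' m₁' n₀' n₁' a' b' e' := by
  subst h₁ h₂ h₃ h₄ h₅ h₆ h₇
  exact h

/-- The surplus antennas of each receiver over `m₁` are used up by the blocks with a two-antenna
receiver. What remains is a symmetric network with `x` antennas everywhere, cut into blocks of size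
3 and one block of size `x % 3`. -/
theorem exists_hasScheme {m₀ m₁ n₀ n₁ x : ℕ} (hn₁ : m₁ ≤ n₁) (hn : n₁ ≤ n₀) (hm : m₁ ≤ m₀)
    (hx : x + n₀ + n₁ = 3 * m₁) :
    HasScheme m₀ m₁ n₀ n₁ (2 * (n₀ - m₁) + 2 * x / 3) (n₁ + m₁ - n₀ - (x + 1) / 3)
      ((x + 1) / 3 - x / 3) := by
  have h := (((hasScheme_first.nsmul (n₀ - m₁)).add (hasScheme_second.nsmul (n₁ - m₁))).add
    (hasScheme_three.nsmul (x / 3))).add (hasScheme_extra_antenna.nsmul (m₀ - m₁))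
  obtain hs | hs | hs : x % 3 = 0 ∨ x % 3 = 1 ∨ x % 3 = 2 := by omega
  · apply hasScheme_of_eq h <;> omega
  · apply hasScheme_of_eq (h.add hasScheme_one) <;> omega
  · apply hasScheme_of_eq (h.add hasScheme_two) <;> omega

/-! ### Analytic dependence of matrices on the channel -/

section Analytic

variable {E : Type*} [NormedAddCommGroup E] [NormedSpace ℝ E] {x : E}

/-- Entrywise analyticity of a matrix-valued function. -/
def MatAnalyticAt {ν μ : Type*} (A : E → Matrix ν μ ℂ) (x : E) : Prop :=
  ∀ i j, AnalyticAt ℝ (fun y => A y i j) x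

theorem MatAnalyticAt.const {ν μ : Type*} (A : Matrix ν μ ℂ) : MatAnalyticAt (fun _ => A) x :=
  fun _ _ => analyticAt_const

theorem MatAnalyticAt.sub {ν μ : Type*} {A B : E → Matrix ν μ ℂ} (hA : MatAnalyticAt A x)
    (hB : MatAnalyticAt B x) : MatAnalyticAt (fun y => A y - B y) x :=
  fun i j => (hA i j).sub (hB i j)

theorem MatAnalyticAt.mul {ν μ κ : Type*} [Fintype μ] {A : E → Matrix ν μ ℂ}
    {B : E → Matrix μ κ ℂ} (hA : MatAnalyticAt A x) (hB : MatAnalyticAt B x) :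
    MatAnalyticAt (fun y => A y * B y) x := fun i j => by
  simp only [Matrix.mul_apply]
  exact Finset.analyticAt_fun_sum _ fun k _ => (hA i k).mul (hB k j)

theorem MatAnalyticAt.mulVec {ν μ : Type*} [Fintype μ] {A : E → Matrix ν μ ℂ}
    {b : E → μ → ℂ} (hA : MatAnalyticAt A x) (hb : ∀ j, AnalyticAt ℝ (fun y => b y j) x) (i : ν) :
    AnalyticAt ℝ (fun y => (A y *ᵥ b y) i) x := by
  simp only [Matrix.mulVec, dotProduct]
  exact Finset.analyticAt_fun_sum _ fun k _ => (hA i k).mul (hb k)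

/-- The scalars are general because the determinant of `schur` is complex, while the one that
certifies independence is real. -/
theorem analyticAt_det {𝕜 ν : Type*} [NormedField 𝕜] [NormedAlgebra ℝ 𝕜] [Fintype ν]
    [DecidableEq ν] {A : E → Matrix ν ν 𝕜} (hA : ∀ i j, AnalyticAt ℝ (fun y => A y i j) x) :
    AnalyticAt ℝ (fun y => (A y).det) x := by
  simp only [Matrix.det_apply']
  exact Finset.analyticAt_fun_sum _ fun σ _ =>
    analyticAt_const.mul (Finset.analyticAt_fun_prod _ fun i _ => hA _ _)

theorem MatAnalyticAt.adjugate {ν : Type*} [Fintype ν] [DecidableEq ν] {A : E → Matrix ν ν ℂ}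
    (hA : MatAnalyticAt A x) : MatAnalyticAt (fun y => (A y).adjugate) x := fun i j => by
  simp only [Matrix.adjugate_apply]
  refine analyticAt_det fun k l => ?_
  by_cases h : k = j
  · subst h
    simpa using analyticAt_const
  · simpa [Matrix.updateRow_ne h] using hA k l

end Analytic

/-! ### Extending aligned pairs to all channels -/

theorem exists_right_inverse {ν μ₀ μ₁ : Type*} [DecidableEq ν] [Fintype μ₀] [Fintype μ₁]
    {A : Matrix ν μ₀ ℂ} {B : Matrix ν μ₁ ℂ} (h : ∀ y, ∃ x₀ x₁, A *ᵥ x₀ - B *ᵥ x₁ = y) :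
    ∃ (L₀ : Matrix μ₀ ν ℂ) (L₁ : Matrix μ₁ ν ℂ), A * L₀ - B * L₁ = 1 := by
  choose y₀ y₁ hy using h
  refine ⟨of fun i j => y₀ (Pi.single j 1) i, of fun i j => y₁ (Pi.single j 1) i, ?_⟩
  ext i j
  have := congrFun (hy (Pi.single j 1)) i
  simpa [Matrix.mul_apply, Matrix.mulVec, dotProduct, Matrix.one_apply, Pi.single_apply] using this

section KernelPair

variable {ν μ₀ μ₁ : Type*} [Fintype ν] [DecidableEq ν] [Fintype μ₀] [Fintype μ₁]

/-- The Schur-type matrix `A L₀ - B L₁`. -/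
def schur (A : Matrix ν μ₀ ℂ) (B : Matrix ν μ₁ ℂ) (L₀ : Matrix μ₀ ν ℂ) (L₁ : Matrix μ₁ ν ℂ) :
    Matrix ν ν ℂ :=
  A * L₀ - B * L₁

/-- The correction that makes `(x₀, x₁)`, scaled by `det (schur A B L₀ L₁)`, a solution of
`A x₀ = B x₁`. -/
def correction (A : Matrix ν μ₀ ℂ) (B : Matrix ν μ₁ ℂ) (L₀ : Matrix μ₀ ν ℂ) (L₁ : Matrix μ₁ ν ℂ)
    (x₀ : μ₀ → ℂ) (x₁ : μ₁ → ℂ) : ν → ℂ :=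
  (schur A B L₀ L₁).adjugate *ᵥ (A *ᵥ x₀ - B *ᵥ x₁)

/-- The first component of a solution of `A x₀ = B x₁` depending polynomially on `A` and `B`. -/
def solFst (A : Matrix ν μ₀ ℂ) (B : Matrix ν μ₁ ℂ) (L₀ : Matrix μ₀ ν ℂ) (L₁ : Matrix μ₁ ν ℂ)
    (x₀ : μ₀ → ℂ) (x₁ : μ₁ → ℂ) : μ₀ → ℂ :=
  (schur A B L₀ L₁).det • x₀ - L₀ *ᵥ correction A B L₀ L₁ x₀ x₁

/-- The second component of a solution of `A x₀ = B x₁` depending polynomially on `A` and `B`. -/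
def solSnd (A : Matrix ν μ₀ ℂ) (B : Matrix ν μ₁ ℂ) (L₀ : Matrix μ₀ ν ℂ) (L₁ : Matrix μ₁ ν ℂ)
    (x₀ : μ₀ → ℂ) (x₁ : μ₁ → ℂ) : μ₁ → ℂ :=
  (schur A B L₀ L₁).det • x₁ - L₁ *ᵥ correction A B L₀ L₁ x₀ x₁

variable (A : Matrix ν μ₀ ℂ) (B : Matrix ν μ₁ ℂ) (L₀ : Matrix μ₀ ν ℂ) (L₁ : Matrix μ₁ ν ℂ)
  (x₀ : μ₀ → ℂ) (x₁ : μ₁ → ℂ)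

/-- With `S = schur A B L₀ L₁`, the identity `S * S.adjugate = S.det • 1` makes the correction
cancel the defect. Nothing is inverted, so this also holds for singular `S`. -/
theorem mulVec_solFst_eq :
    A *ᵥ solFst A B L₀ L₁ x₀ x₁ = B *ᵥ solSnd A B L₀ L₁ x₀ x₁ := by
  have h : A *ᵥ (L₀ *ᵥ correction A B L₀ L₁ x₀ x₁) - B *ᵥ (L₁ *ᵥ correction A B L₀ L₁ x₀ x₁) =
      (schur A B L₀ L₁).det • (A *ᵥ x₀ - B *ᵥ x₁) := by
    rw [mulVec_mulVec, mulVec_mulVec, ← sub_mulVec]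
    change schur A B L₀ L₁ *ᵥ _ = _
    rw [correction, mulVec_mulVec, mul_adjugate, smul_mulVec, one_mulVec]
  rw [← sub_eq_zero]
  simp only [solFst, solSnd, mulVec_sub, mulVec_smul]
  rw [sub_sub_sub_comm, h, smul_sub, sub_self]

variable {A B L₀ L₁ x₀ x₁}

theorem solFst_eq_self (hL : A * L₀ - B * L₁ = 1) (hx : A *ᵥ x₀ = B *ᵥ x₁) :
    solFst A B L₀ L₁ x₀ x₁ = x₀ := by
  simp [solFst, correction, schur, hL, hx]

theorem solSnd_eq_self (hL : A * L₀ - B * L₁ = 1) (hx : A *ᵥ x₀ = B *ᵥ x₁) :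
    solSnd A B L₀ L₁ x₀ x₁ = x₁ := by
  simp [solSnd, correction, schur, hL, hx]

theorem MatAnalyticAt.schur {E ν μ₀ μ₁ : Type*} [NormedAddCommGroup E] [NormedSpace ℝ E] [Fintype μ₀]
    [Fintype μ₁] {x : E} {F : E → Matrix ν μ₀ ℂ} {G : E → Matrix ν μ₁ ℂ} (hF : MatAnalyticAt F x)
    (hG : MatAnalyticAt G x) (L₀ : Matrix μ₀ ν ℂ) (L₁ : Matrix μ₁ ν ℂ) :
    MatAnalyticAt (fun y => MIMOX.schur (F y) (G y) L₀ L₁) x :=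
  (hF.mul (.const L₀)).sub (hG.mul (.const L₁))

section

variable {E : Type*} [NormedAddCommGroup E] [NormedSpace ℝ E] {x : E} {F : E → Matrix ν μ₀ ℂ}
  {G : E → Matrix ν μ₁ ℂ}

theorem MatAnalyticAt.correction_apply (hF : MatAnalyticAt F x) (hG : MatAnalyticAt G x) (j : ν) :
    AnalyticAt ℝ (fun y => correction (F y) (G y) L₀ L₁ x₀ x₁ j) x := by
  have h1 : MatAnalyticAt (fun y => (MIMOX.schur (F y) (G y) L₀ L₁).adjugate) x :=
    (hF.schur hG L₀ L₁).adjugate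
  have h2 (k : ν) : AnalyticAt ℝ (fun y => (F y *ᵥ x₀) k) x :=
    hF.mulVec (b := fun _ => x₀) (fun _ => analyticAt_const) k
  have h3 (k : ν) : AnalyticAt ℝ (fun y => (G y *ᵥ x₁) k) x :=
    hG.mulVec (b := fun _ => x₁) (fun _ => analyticAt_const) k
  exact h1.mulVec (b := fun y => F y *ᵥ x₀ - G y *ᵥ x₁) (fun k => (h2 k).sub (h3 k)) j

theorem MatAnalyticAt.solFst_apply (hF : MatAnalyticAt F x) (hG : MatAnalyticAt G x) (j : μ₀) :
    AnalyticAt ℝ (fun y => solFst (F y) (G y) L₀ L₁ x₀ x₁ j) x := by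
  have h1 : AnalyticAt ℝ (fun y => (MIMOX.schur (F y) (G y) L₀ L₁).det) x :=
    analyticAt_det (hF.schur hG L₀ L₁)
  exact (h1.mul analyticAt_const).sub
    ((MatAnalyticAt.const L₀).mulVec (fun k => hF.correction_apply hG k) j)

theorem MatAnalyticAt.solSnd_apply (hF : MatAnalyticAt F x) (hG : MatAnalyticAt G x) (j : μ₁) :
    AnalyticAt ℝ (fun y => solSnd (F y) (G y) L₀ L₁ x₀ x₁ j) x := by
  have h1 : AnalyticAt ℝ (fun y => (MIMOX.schur (F y) (G y) L₀ L₁).det) x :=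
    analyticAt_det (hF.schur hG L₀ L₁)
  exact (h1.mul analyticAt_const).sub
    ((MatAnalyticAt.const L₁).mulVec (fun k => hF.correction_apply hG k) j)

end

end KernelPair

/-! ### Generic independence -/

/-- Serves twice: its determinant certifies independence near and far from the reference channel,
and its coordinates are the zero-forcing functionals. -/
theorem exists_dual_family {ι E : Type*} [Fintype ι] [DecidableEq ι] [AddCommGroup E] [Module ℝ E]
    {v : ι → E} (hv : LinearIndependent ℝ v) :
    ∃ P : E →ₗ[ℝ] ι → ℝ, ∀ j, P (v j) = Pi.single j 1 := by
  obtain ⟨P, hP⟩ := (Fintype.linearCombination ℝ v).exists_leftInverse_of_injective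
    (LinearMap.ker_eq_bot'.2 fun g hg => funext (Fintype.linearIndependent_iff.1 hv g hg))
  refine ⟨P, fun j => ?_⟩
  simpa using LinearMap.congr_fun hP (Pi.single j 1)

theorem linearIndependent_of_det_ne_zero {ι E : Type*} [Fintype ι] [DecidableEq ι] [AddCommGroup E]
    [Module ℝ E] {v : ι → E} (P : E →ₗ[ℝ] ι → ℝ) (h : (of fun j => P (v j)).det ≠ 0) :
    LinearIndependent ℝ v :=
  LinearIndependent.of_comp P (linearIndependent_rows_of_det_ne_zero h)

/-- Linear independence of an analytic family of vectors is a generic property. -/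
theorem exists_analytic_linearIndependent {E ι ν : Type*} [NormedAddCommGroup E] [NormedSpace ℝ E]
    [Fintype ι] [Fintype ν] {v : E → ι → ν → ℂ}
    (hv : ∀ x j k, AnalyticAt ℝ (fun y => v y j k) x) {x₀ : E} (h₀ : LinearIndependent ℝ (v x₀)) :
    ∃ D : E → ℝ, AnalyticOnNhd ℝ D Set.univ ∧ D x₀ ≠ 0 ∧
      ∀ x, D x ≠ 0 → LinearIndependent ℝ (v x) := by
  classical
  obtain ⟨P, hP⟩ := exists_dual_family h₀
  refine ⟨fun x => (of fun j => P (v x j)).det, fun x _ => ?_, ?_,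
    fun x hx => linearIndependent_of_det_ne_zero P hx⟩
  · refine analyticAt_det fun j i => ?_
    exact (((LinearMap.proj i ∘ₗ P : (ν → ℂ) →ₗ[ℝ] ℝ).toContinuousLinearMap).analyticAt _).comp
      (analyticAt_pi_iff.2 (hv x j))
  · have : (of fun j => P (v x₀ j)) = (1 : Matrix ι ι ℝ) := by
      ext i j
      simp [hP, Matrix.one_apply, Pi.single_apply, eq_comm]
    simp [this]

theorem matAnalyticAt_mat {M N : Fin 2 → ℕ} (r t : Fin 2) (x : Channel M N) :
    MatAnalyticAt (fun H : Channel M N => H.mat r t) x := fun i j =>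
  ((LinearMap.proj j ∘ₗ LinearMap.proj i ∘ₗ LinearMap.proj t ∘ₗ LinearMap.proj r :
    Channel M N →ₗ[ℝ] ℂ).toContinuousLinearMap).analyticAt x

theorem analyticAt_quad {E α β γ δ ν : Type*} [NormedAddCommGroup E] [NormedSpace ℝ E]
    {a : E → α → ν → ℂ} {b : E → β → ν → ℂ} {c : E → γ → ν → ℂ} {d : E → δ → ν → ℂ} {x : E}
    (ha : ∀ i k, AnalyticAt ℝ (fun y => a y i k) x) (hb : ∀ i k, AnalyticAt ℝ (fun y => b y i k) x)
    (hc : ∀ i k, AnalyticAt ℝ (fun y => c y i k) x) (hd : ∀ i k, AnalyticAt ℝ (fun y => d y i k) x)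
    (i : (α ⊕ β) ⊕ (γ ⊕ δ)) (k : ν) :
    AnalyticAt ℝ (fun y => quad (a y) (b y) (c y) (d y) i k) x := by
  rcases i with (i | i) | (i | i)
  exacts [ha i k, hb i k, hc i k, hd i k]

/-- If one channel admits an alignment scheme, almost every channel does. -/
theorem ae_exists_isScheme {M N : Fin 2 → ℕ} {a b e : ℕ}
    (h : HasScheme (M 0) (M 1) (N 0) (N 1) a b e) (m : Fin 2 → Fin 2 → ℂ)
    {v : Fin 2 → Fin 2 → ℝ≥0} (hv : ∀ r t, v r t ≠ 0) :
    ∀ᵐ H ∂(channelLaw M N m v), ∃ (u₀ : Fin a → Fin (M 0) → ℂ) (u₁ : Fin a → Fin (M 1) → ℂ)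
      (w₀ : Fin b → Fin (M 0) → ℂ) (w₁ : Fin b → Fin (M 1) → ℂ) (f : Fin e → Fin (M 1) → ℂ),
      IsScheme (H.mat 0 0) (H.mat 0 1) (H.mat 1 0) (H.mat 1 1) u₀ u₁ w₀ w₁ f := by
  obtain ⟨H₀₀, H₀₁, H₁₀, H₁₁, u₀, u₁, w₀, w₁, f, s₀, s₁, h⟩ := h
  obtain ⟨K₀, K₁, hK⟩ := exists_right_inverse s₀
  obtain ⟨L₀, L₁, hL⟩ := exists_right_inverse s₁
  let Hs : Channel M N := fun r t => match r, t with
    | 0, 0 => H₀₀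
    | 0, 1 => H₀₁
    | 1, 0 => H₁₀
    | 1, 1 => H₁₁
  -- Streams for one receiver have to align at the other, hence the matrices into the other
  -- receiver. The vectors `f` carry no constraint and stay constant.
  let U₀ (H : Channel M N) (i : Fin a) := solFst (H.mat 1 0) (H.mat 1 1) L₀ L₁ (u₀ i) (u₁ i)
  let U₁ (H : Channel M N) (i : Fin a) := solSnd (H.mat 1 0) (H.mat 1 1) L₀ L₁ (u₀ i) (u₁ i)
  let W₀ (H : Channel M N) (i : Fin b) := solFst (H.mat 0 0) (H.mat 0 1) K₀ K₁ (w₀ i) (w₁ i)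
  let W₁ (H : Channel M N) (i : Fin b) := solSnd (H.mat 0 0) (H.mat 0 1) K₀ K₁ (w₀ i) (w₁ i)
  have hU₀ : U₀ Hs = u₀ := funext fun i => solFst_eq_self hL (h.align₁ i)
  have hU₁ : U₁ Hs = u₁ := funext fun i => solSnd_eq_self hL (h.align₁ i)
  have hW₀ : W₀ Hs = w₀ := funext fun i => solFst_eq_self hK (h.align₀ i)
  have hW₁ : W₁ Hs = w₁ := funext fun i => solSnd_eq_self hK (h.align₀ i)
  have aU₀ (x) (i) (j) : AnalyticAt ℝ (fun H => U₀ H i j) x :=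
    (matAnalyticAt_mat 1 0 x).solFst_apply (matAnalyticAt_mat 1 1 x) j
  have aU₁ (x) (i) (j) : AnalyticAt ℝ (fun H => U₁ H i j) x :=
    (matAnalyticAt_mat 1 0 x).solSnd_apply (matAnalyticAt_mat 1 1 x) j
  have aW₀ (x) (i) (j) : AnalyticAt ℝ (fun H => W₀ H i j) x :=
    (matAnalyticAt_mat 0 0 x).solFst_apply (matAnalyticAt_mat 0 1 x) j
  have aW₁ (x) (i) (j) : AnalyticAt ℝ (fun H => W₁ H i j) x :=
    (matAnalyticAt_mat 0 0 x).solSnd_apply (matAnalyticAt_mat 0 1 x) j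
  obtain ⟨D₀, aD₀, nD₀, hD₀⟩ := exists_analytic_linearIndependent (x₀ := Hs)
    (v := fun H : Channel M N => quad (fun i => H.mat 0 0 *ᵥ U₀ H i) (fun i => H.mat 0 1 *ᵥ U₁ H i)
      (fun i => H.mat 0 0 *ᵥ W₀ H i) (fun i => H.mat 0 1 *ᵥ f i))
    (fun x => analyticAt_quad
      (fun i => (matAnalyticAt_mat 0 0 x).mulVec (aU₀ x i))
      (fun i => (matAnalyticAt_mat 0 1 x).mulVec (aU₁ x i))
      (fun i => (matAnalyticAt_mat 0 0 x).mulVec (aW₀ x i))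
      (fun i => (matAnalyticAt_mat 0 1 x).mulVec fun _ => analyticAt_const))
    (by simp only [hU₀, hU₁, hW₀]; exact h.indep₀)
  obtain ⟨D₁, aD₁, nD₁, hD₁⟩ := exists_analytic_linearIndependent (x₀ := Hs)
    (v := fun H : Channel M N => quad (fun i => H.mat 1 0 *ᵥ W₀ H i) (fun i => H.mat 1 1 *ᵥ W₁ H i)
      (fun i => H.mat 1 1 *ᵥ f i) (fun i => H.mat 1 0 *ᵥ U₀ H i))
    (fun x => analyticAt_quad
      (fun i => (matAnalyticAt_mat 1 0 x).mulVec (aW₀ x i))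
      (fun i => (matAnalyticAt_mat 1 1 x).mulVec (aW₁ x i))
      (fun i => (matAnalyticAt_mat 1 1 x).mulVec fun _ => analyticAt_const)
      (fun i => (matAnalyticAt_mat 1 0 x).mulVec (aU₀ x i)))
    (by simp only [hU₀, hW₁, hW₀]; exact h.indep₁)
  filter_upwards [analyticNull_channelLaw m hv D₀ aD₀ ⟨Hs, nD₀⟩,
    analyticNull_channelLaw m hv D₁ aD₁ ⟨Hs, nD₁⟩] with H h₀ h₁
  exact ⟨U₀ H, U₁ H, W₀ H, W₁ H, f, fun i => mulVec_solFst_eq .., fun i => mulVec_solFst_eq ..,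
    hD₀ H h₀, hD₁ H h₁⟩

/-! ### From schemes to precoders and zero forcing -/

/-- Restrict to a section of `g`. A relabelling of the directions then only has to be checked for
surjectivity. -/
theorem linearIndependent_of_comp_surjective {ι κ E : Type*} [AddCommGroup E] [Module ℝ E]
    {v : ι → E} {g : κ → ι} (hg : Function.Surjective g) (h : LinearIndependent ℝ (v ∘ g)) :
    LinearIndependent ℝ v := by
  have h1 := h.comp _ (Function.injective_surjInv hg)
  rwa [Function.comp_assoc, Function.RightInverse.comp_eq_id (Function.rightInverse_surjInv hg)] at h1

/-- The lengths of the message blocks of a scheme with `a` aligned pairs of streams for the first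
receiver, `b` aligned pairs for the second, and `e` additional streams from the second transmitter
to the second receiver. -/
def blockLength (a b e : ℕ) : Fin 2 → Fin 2 → ℕ
  | 0, 0 => a
  | 0, 1 => a
  | 1, 0 => b
  | 1, 1 => b + e

variable {M N : Fin 2 → ℕ} {a b e : ℕ}

/-- The precoders of a scheme. -/
def IsScheme.precoders (u₀ : Fin a → Fin (M 0) → ℂ) (u₁ : Fin a → Fin (M 1) → ℂ)
    (w₀ : Fin b → Fin (M 0) → ℂ) (w₁ : Fin b → Fin (M 1) → ℂ) (f : Fin e → Fin (M 1) → ℂ) :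
    Precoders M (blockLength a b e)
  | 0, 0 => u₀
  | 0, 1 => u₁
  | 1, 0 => w₀
  | 1, 1 => Fin.append w₁ f

theorem IsScheme.isAlignmentScheme {H : Channel M N} {u₀ : Fin a → Fin (M 0) → ℂ}
    {u₁ : Fin a → Fin (M 1) → ℂ} {w₀ : Fin b → Fin (M 0) → ℂ} {w₁ : Fin b → Fin (M 1) → ℂ}
    {f : Fin e → Fin (M 1) → ℂ}
    (h : IsScheme (H.mat 0 0) (H.mat 0 1) (H.mat 1 0) (H.mat 1 1) u₀ u₁ w₀ w₁ f) :
    IsAlignmentScheme H (IsScheme.precoders u₀ u₁ w₀ w₁ f)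
      (fun r => min (blockLength a b e r 0) (blockLength a b e r 1)) where
  le_length r := Fin.forall_fin_two.2 ⟨min_le_left _ _, min_le_right _ _⟩
  aligned := by
    refine Fin.forall_fin_two.2 ⟨fun i _ h₀ h₁ => ?_, fun i _ h₀ h₁ => ?_⟩
    · change H.mat 0 0 *ᵥ w₀ ⟨i, h₀⟩ = H.mat 0 1 *ᵥ Fin.append w₁ f (Fin.castAdd e ⟨i, h₀⟩)
      rw [Fin.append_left]
      exact h.align₀ _
    · exact h.align₁ ⟨i, h₀⟩
  independent := by
    refine Fin.forall_fin_two.2 ⟨?_, ?_⟩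
    · let g : (Fin a ⊕ Fin a) ⊕ (Fin b ⊕ Fin e) →
          (Σ t : Fin 2, Fin (blockLength a b e 0 t)) ⊕ (Fin (blockLength a b e 1 0) ⊕
            {i : Fin (blockLength a b e 1 1) //
              min (blockLength a b e 1 0) (blockLength a b e 1 1) ≤ (i : ℕ)}) :=
        Sum.elim (Sum.elim (fun i => Sum.inl ⟨0, i⟩) (fun i => Sum.inl ⟨1, i⟩))
          (Sum.elim (fun i => Sum.inr (Sum.inl i))
            (fun i => Sum.inr (Sum.inr ⟨Fin.natAdd b i, (min_le_left _ _).trans (by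
              change b ≤ b + (i : ℕ); omega)⟩)))
      refine linearIndependent_of_comp_surjective (g := g) ?_ ?_
      · rintro (⟨t, i⟩ | i | ⟨i, hi⟩)
        · revert t
          exact Fin.forall_fin_two.2 ⟨fun i => ⟨.inl (.inl i), rfl⟩, fun i => ⟨.inl (.inr i), rfl⟩⟩
        · exact ⟨.inr (.inl i), rfl⟩
        · have hb : b ≤ (i : ℕ) := (le_min le_rfl (Nat.le_add_right b e)).trans hi
          have hi2 : (i : ℕ) < b + e := i.2
          refine ⟨.inr (.inr ⟨i - b, by omega⟩), ?_⟩
          refine congrArg (Sum.inr ∘ Sum.inr) (Subtype.ext (Fin.ext ?_))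
          change b + ((i : ℕ) - b) = i
          omega
      · refine linearIndependent_congr h.indep₀ ?_
        rintro ((i | i) | (i | i))
        · rfl
        · rfl
        · rfl
        · change H.mat 0 1 *ᵥ Fin.append w₁ f (Fin.natAdd b i) = H.mat 0 1 *ᵥ f i
          rw [Fin.append_right]
    · let g : (Fin b ⊕ Fin b) ⊕ (Fin e ⊕ Fin a) →
          (Σ t : Fin 2, Fin (blockLength a b e 1 t)) ⊕ (Fin (blockLength a b e 0 0) ⊕
            {i : Fin (blockLength a b e 0 1) //
              min (blockLength a b e 0 0) (blockLength a b e 0 1) ≤ (i : ℕ)}) :=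
        Sum.elim (Sum.elim (fun i => Sum.inl ⟨0, i⟩) (fun i => Sum.inl ⟨1, Fin.castAdd e i⟩))
          (Sum.elim (fun i => Sum.inl ⟨1, Fin.natAdd b i⟩) (fun i => Sum.inr (Sum.inl i)))
      refine linearIndependent_of_comp_surjective (g := g) ?_ ?_
      · rintro (⟨t, i⟩ | i | ⟨i, hi⟩)
        · revert t
          refine Fin.forall_fin_two.2 ⟨fun i => ⟨.inl (.inl i), rfl⟩, fun (i : Fin (b + e)) => ?_⟩
          refine Fin.addCases (fun i => ?_) (fun i => ?_) i
          · exact ⟨.inl (.inr i), rfl⟩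
          · exact ⟨.inr (.inl i), rfl⟩
        · exact ⟨.inr (.inr i), rfl⟩
        -- Every stream for the first receiver is aligned, so there is no such index.
        · have ha : a ≤ (i : ℕ) := (le_min le_rfl le_rfl).trans hi
          exact absurd i.2 ha.not_gt
      · refine linearIndependent_congr h.indep₁ ?_
        rintro ((i | i) | (i | i))
        · rfl
        · change H.mat 1 1 *ᵥ Fin.append w₁ f (Fin.castAdd e i) = H.mat 1 1 *ᵥ w₁ i
          rw [Fin.append_left]
        · change H.mat 1 1 *ᵥ Fin.append w₁ f (Fin.natAdd b i) = H.mat 1 1 *ᵥ f i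
          rw [Fin.append_right]
        · rfl

/-- Zero forcing: every desired stream can be separated from all other streams. -/
theorem IsAlignmentScheme.exists_zeroForcing {Q : Fin 2 → Fin 2 → ℕ} {H : Channel M N}
    {V : Precoders M Q} {a : Fin 2 → ℕ} (h : IsAlignmentScheme H V a) (r t : Fin 2)
    (i : Fin (Q r t)) :
    ∃ φ : (Fin (N r) → ℂ) →ₗ[ℝ] ℝ,
      (∀ s : Σ t, Fin (Q r t), φ (H.mat r s.1 *ᵥ V r s.1 s.2) =
        (Pi.single (⟨t, i⟩ : Σ t, Fin (Q r t)) 1 : (Σ t, Fin (Q r t)) → ℝ) s) ∧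
      ∀ t' i', φ (H.mat r t' *ᵥ V r.rev t' i') = 0 := by
  classical
  obtain ⟨P, hP⟩ := exists_dual_family (h.independent r)
  have h0 (i' : Fin (Q r.rev 0)) :
      LinearMap.proj (R := ℝ) (φ := fun _ => ℝ) (Sum.inl ⟨t, i⟩) (P (H.mat r 0 *ᵥ V r.rev 0 i')) = 0 := by
    have := congrFun (hP (Sum.inr (Sum.inl i'))) (Sum.inl ⟨t, i⟩)
    simpa [receivedDirections] using this
  refine ⟨LinearMap.proj (R := ℝ) (φ := fun _ => ℝ) (Sum.inl ⟨t, i⟩) ∘ₗ P, fun s => ?_,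
    Fin.forall_fin_two.2 ⟨h0, fun i' => ?_⟩⟩
  · have := congrFun (hP (Sum.inl s)) (Sum.inl ⟨t, i⟩)
    simpa [receivedDirections, Pi.single_apply, eq_comm] using this
  · by_cases hi : a r.rev ≤ (i' : ℕ)
    · have := congrFun (hP (Sum.inr (Sum.inr ⟨i', hi⟩))) (Sum.inl ⟨t, i⟩)
      simpa [receivedDirections] using this
    · rw [not_le] at hi
      -- An aligned stream arrives along the direction of its partner, which is already killed.
      have := h0 ⟨i', hi.trans_le (h.le_length _ _)⟩
      rwa [h.aligned r i' hi _ i'.2] at this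

/-! ### Codebooks of integer words -/

/-- A greedy packing: a maximal set of pairwise non-close points. -/
theorem exists_packing {X : Type*} [Fintype X] (close : X → X → Prop) [DecidableRel close]
    (hrefl : ∀ x, close x x) (hsymm : ∀ x y, close x y → close y x) {B : ℝ}
    (hB : ∀ x, ((Finset.univ.filter (close x)).card : ℝ) ≤ B) :
    ∃ S : Finset X, (∀ x ∈ S, ∀ y ∈ S, close x y → x = y) ∧ (Fintype.card X : ℝ) ≤ S.card * B := by
  classical
  let good := Finset.univ.filter fun S : Finset X => ∀ x ∈ S, ∀ y ∈ S, close x y → x = y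
  obtain ⟨S, hS, hmax⟩ := good.exists_max_image Finset.card ⟨∅, by simp [good]⟩
  have hS' : ∀ x ∈ S, ∀ y ∈ S, close x y → x = y := (Finset.mem_filter.1 hS).2
  refine ⟨S, hS', ?_⟩
  have hcov : ∀ y, ∃ x ∈ S, close x y := by
    intro y
    by_contra! hy
    have hyS : y ∉ S := fun h => hy y h (hrefl y)
    have h1 : insert y S ∈ good := by
      refine Finset.mem_filter.2 ⟨Finset.mem_univ _, fun x hx z hz hxz => ?_⟩
      rcases Finset.mem_insert.1 hx with rfl | hx' <;> rcases Finset.mem_insert.1 hz with rfl | hz'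
      · rfl
      · exact absurd (hsymm _ _ hxz) (hy z hz')
      · exact absurd hxz (hy x hx')
      · exact hS' x hx' z hz' hxz
    have h2 := hmax _ h1
    rw [Finset.card_insert_of_notMem hyS] at h2
    omega
  have h3 : (Finset.univ : Finset X) ⊆ S.biUnion fun x => Finset.univ.filter (close x) := by
    intro y _
    obtain ⟨x, hx, hxy⟩ := hcov y
    exact Finset.mem_biUnion.2 ⟨x, hx, by simpa using hxy⟩
  calc (Fintype.card X : ℝ) ≤ ((S.biUnion fun x => Finset.univ.filter (close x)).card : ℝ) := by
        exact_mod_cast Finset.card_le_card h3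
    _ ≤ ∑ x ∈ S, ((Finset.univ.filter (close x)).card : ℝ) := by
        exact_mod_cast Finset.card_biUnion_le
    _ ≤ ∑ _x ∈ S, B := Finset.sum_le_sum fun x _ => hB x
    _ = S.card * B := by simp

theorem summable_half_pow_natAbs : Summable fun z : ℤ => ((1 : ℝ) / 2) ^ z.natAbs := by
  rw [summable_int_iff_summable_nat_and_neg]
  constructor <;> simpa using summable_geometric_two

/-- The sum of `2 ^ (-|z|)` over the integers. -/
noncomputable def intWeight : ℝ := ∑' z : ℤ, ((1 : ℝ) / 2) ^ z.natAbs

theorem intWeight_pos : 0 < intWeight :=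
  summable_half_pow_natAbs.tsum_pos (fun _ => by positivity) 0 (by simp)

theorem sum_half_pow_natAbs_le {q : ℕ} (a : ℤ) :
    ∑ b : Fin q, ((1 : ℝ) / 2) ^ (a - (b : ℕ)).natAbs ≤ intWeight := by
  have hinj : Function.Injective fun b : Fin q => a - ((b : ℕ) : ℤ) := by
    intro b c h
    simp only [sub_right_inj, Nat.cast_inj] at h
    exact Fin.ext h
  have h := summable_half_pow_natAbs.sum_le_tsum (Finset.univ.map ⟨_, hinj⟩)
    (fun _ _ => by positivity)
  simpa [intWeight] using h

/-- The `ℓ¹` distance of two integer words. -/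
def wordDist {n q : ℕ} (x y : Fin n → Fin q) : ℕ := ∑ k, ((x k : ℕ) - (y k : ℕ) : ℤ).natAbs

/-- Weight each word by `2 ^ (-distance)`: words in the ball weigh at least `2 ^ (-d * n)`, and the
total weight factors over coordinates. The bound does not involve `q`, which is what keeps the rate
loss bounded as the power grows. -/
theorem card_wordDist_le {n q : ℕ} (x : Fin n → Fin q) (d : ℕ) :
    ((Finset.univ.filter fun y => wordDist x y ≤ d * n).card : ℝ) ≤ (2 ^ d * intWeight) ^ n := by
  have h1 (y : Fin n → Fin q) (hy : y ∈ Finset.univ.filter fun y => wordDist x y ≤ d * n) :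
      (1 : ℝ) ≤ (2 ^ d) ^ n * ∏ k, ((1 : ℝ) / 2) ^ ((x k : ℕ) - (y k : ℕ) : ℤ).natAbs := by
    have hy : wordDist x y ≤ d * n := (Finset.mem_filter.1 hy).2
    rw [Finset.prod_pow_eq_pow_sum, ← pow_mul]
    change 1 ≤ 2 ^ (d * n) * (1 / 2 : ℝ) ^ wordDist x y
    calc (1 : ℝ) = 2 ^ (d * n) * (1 / 2 : ℝ) ^ (d * n) := by
          rw [← mul_pow]; norm_num
      _ ≤ _ := by
          gcongr 2 ^ (d * n) * ?_
          exact pow_le_pow_of_le_one (by norm_num) (by norm_num) hy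
  calc ((Finset.univ.filter fun y => wordDist x y ≤ d * n).card : ℝ)
      = ∑ y ∈ Finset.univ.filter fun y => wordDist x y ≤ d * n, (1 : ℝ) := by simp
    _ ≤ ∑ y ∈ Finset.univ.filter fun y => wordDist x y ≤ d * n,
          (2 ^ d) ^ n * ∏ k, ((1 : ℝ) / 2) ^ ((x k : ℕ) - (y k : ℕ) : ℤ).natAbs :=
        Finset.sum_le_sum h1
    _ ≤ ∑ y : Fin n → Fin q,
          (2 ^ d) ^ n * ∏ k, ((1 : ℝ) / 2) ^ ((x k : ℕ) - (y k : ℕ) : ℤ).natAbs :=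
        Finset.sum_le_univ_sum_of_nonneg fun y => by positivity
    _ = (2 ^ d) ^ n * ∏ k, ∑ b : Fin q, ((1 : ℝ) / 2) ^ ((x k : ℕ) - (b : ℕ) : ℤ).natAbs := by
        rw [← Finset.mul_sum, Finset.prod_univ_sum, Fintype.piFinset_univ]
    _ ≤ (2 ^ d) ^ n * ∏ _k : Fin n, intWeight := by
        gcongr with k
        exact sum_half_pow_natAbs_le _
    _ = (2 ^ d * intWeight) ^ n := by simp [mul_pow]

/-- There are large sets of integer words with pairwise `ℓ¹` distances of more than `d * n`. -/
theorem exists_code_words (n d : ℕ) {q : ℕ} (hq : 0 < q) :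
    ∃ s : ℕ, 0 < s ∧ ((q : ℝ) / (2 ^ d * intWeight)) ^ n ≤ s ∧ ∃ c : Fin s → Fin n → Fin q,
      ∀ i j, ∑ k, |((c i k : ℕ) : ℝ) - ((c j k : ℕ) : ℝ)| ≤ d * n → i = j := by
  have hC : 0 < 2 ^ d * intWeight := mul_pos (by positivity) intWeight_pos
  have hsymm (x y : Fin n → Fin q) : wordDist x y = wordDist y x :=
    Finset.sum_congr rfl fun k _ => by omega
  obtain ⟨S, hS, hcard⟩ := exists_packing (fun x y : Fin n → Fin q => wordDist x y ≤ d * n)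
    (fun x => by simp [wordDist]) (fun x y h => by rwa [hsymm]) (fun x => card_wordDist_le x d)
  have hcard' : ((q : ℝ) / (2 ^ d * intWeight)) ^ n ≤ S.card := by
    rw [div_pow, div_le_iff₀ (by positivity)]
    simpa using hcard
  have hq' : (0 : ℝ) < q := by exact_mod_cast hq
  have hpos : 0 < S.card := by
    have : (0 : ℝ) < S.card := lt_of_lt_of_le (by positivity) hcard'
    exact_mod_cast this
  refine ⟨S.card, hpos, hcard', fun i => S.equivFin.symm i, fun i j hij => ?_⟩
  have h1 : wordDist (S.equivFin.symm i : Fin n → Fin q) (S.equivFin.symm j) ≤ d * n := by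
    have h2 : ((wordDist (S.equivFin.symm i : Fin n → Fin q) (S.equivFin.symm j) : ℕ) : ℝ) =
        ∑ k, |(((S.equivFin.symm i : Fin n → Fin q) k : ℕ) : ℝ) -
          (((S.equivFin.symm j : Fin n → Fin q) k : ℕ) : ℝ)| := by
      rw [wordDist, Nat.cast_sum]
      refine Finset.sum_congr rfl fun k _ => ?_
      rw [Nat.cast_natAbs]
      push_cast
      rfl
    rw [← h2] at hij
    exact_mod_cast hij
  exact S.equivFin.symm.injective (Subtype.ext (hS _ (S.equivFin.symm i).2 _
    (S.equivFin.symm j).2 h1))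

/-! ### Decoding, noise and power -/

/-- A measurable selection among finitely many alternatives. -/
theorem exists_measurable_decoder {Y : Type*} [MeasurableSpace Y] {s : ℕ} (hs : 0 < s)
    {cond : Fin s → Set Y} (hc : ∀ m, MeasurableSet (cond m)) :
    ∃ dec : Y → Fin s, Measurable dec ∧
      ∀ y w, y ∈ cond w → (∀ m, y ∈ cond m → m = w) → dec y = w := by
  classical
  -- The choice depends only on a finite truth table, so it is measurable however it is made;
  -- message `0` is an arbitrary default.
  let g : (Fin s → Prop) → Fin s := fun p => if h : ∃ m, p m then h.choose else ⟨0, hs⟩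
  refine ⟨fun y => g fun m => y ∈ cond m, ?_, fun y w hw hu => ?_⟩
  · have h1 : Measurable fun y => (fun m => y ∈ cond m : Fin s → Prop) :=
      measurable_pi_iff.2 fun m => (hc m).mem
    exact (measurable_of_countable g).comp h1
  · have hex : ∃ m, y ∈ cond m := ⟨w, hw⟩
    simp only [g, dif_pos hex]
    exact hu _ hex.choose_spec

theorem integrable_exp_mul_abs_gaussianReal (v : ℝ≥0) (K : ℝ) :
    Integrable (fun x => Real.exp (K * |x|)) (gaussianReal 0 v) :=
  integrable_exp_mul_abs (X := fun x => x) (integrable_exp_mul_gaussianReal K)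
    (by simpa using integrable_exp_mul_gaussianReal (-K))

theorem integrable_exp_mul_norm_complexGaussian (v : ℝ≥0) {K : ℝ} (hK : 0 ≤ K) :
    Integrable (fun z : ℂ => Real.exp (K * ‖z‖)) (complexGaussian 0 v) := by
  rw [complexGaussian, integrable_map_equiv]
  have h := (integrable_exp_mul_abs_gaussianReal (v / 2) K).mul_prod
    (integrable_exp_mul_abs_gaussianReal (v / 2) K)
  refine h.mono' (Continuous.aestronglyMeasurable ?_) (ae_of_all _ fun p => ?_)
  · have : Continuous fun p : ℝ × ℝ => Complex.equivRealProdCLM.symm p :=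
      Complex.equivRealProdCLM.symm.continuous
    exact Real.continuous_exp.comp (continuous_const.mul this.norm)
  · change ‖Real.exp (K * ‖Complex.measurableEquivRealProd.symm p‖)‖ ≤ _
    rw [Real.norm_of_nonneg (Real.exp_pos _).le, ← Real.exp_add, ← mul_add]
    refine Real.exp_le_exp.2 (mul_le_mul_of_nonneg_left ?_ hK)
    exact Complex.norm_le_abs_re_add_abs_im _

/-- Chernoff bound for the norm of the noise. -/
theorem noiseLaw_norm_le (n N : ℕ) {K T : ℝ} (hK : 0 ≤ K) :
    Code.noiseLaw n N {z | T * n ≤ ∑ k, ∑ j, K * ‖z k j‖} ≤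
      ENNReal.ofReal ((Real.exp (-T) * (∫ z, Real.exp (K * ‖z‖) ∂(complexGaussian 0 1)) ^ N) ^ n) := by
  have hprob : IsProbabilityMeasure (Code.noiseLaw n N) := by
    unfold Code.noiseLaw; infer_instance
  have hint := integrable_exp_mul_norm_complexGaussian 1 hK
  have hfun : (fun z : Fin n → Fin N → ℂ => Real.exp (1 * ∑ k, ∑ j, K * ‖z k j‖)) =
      fun z => ∏ k, ∏ j, Real.exp (K * ‖z k j‖) := by
    funext z
    rw [one_mul, Real.exp_sum]
    exact Finset.prod_congr rfl fun k _ => Real.exp_sum _ _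
  have hint1 : Integrable (fun z : Fin n → Fin N → ℂ => Real.exp (1 * ∑ k, ∑ j, K * ‖z k j‖))
      (Code.noiseLaw n N) := by
    rw [hfun]
    exact Integrable.fintype_prod (f := fun _ (y : Fin N → ℂ) => ∏ j, Real.exp (K * ‖y j‖))
      fun _ => Integrable.fintype_prod (f := fun _ (w : ℂ) => Real.exp (K * ‖w‖)) fun _ => hint
  have h := measure_ge_le_exp_mul_mgf (T * n) zero_le_one hint1
  have hmgf : mgf (fun z : Fin n → Fin N → ℂ => ∑ k, ∑ j, K * ‖z k j‖) (Code.noiseLaw n N) 1 =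
      ((∫ z, Real.exp (K * ‖z‖) ∂(complexGaussian 0 1)) ^ N) ^ n := by
    rw [mgf, hfun, Code.noiseLaw,
      integral_fintype_prod_eq_pow (fun y : Fin N → ℂ => ∏ j, Real.exp (K * ‖y j‖)),
      integral_fintype_prod_eq_pow (fun w : ℂ => Real.exp (K * ‖w‖))]
    simp
  rw [hmgf] at h
  rw [← ofReal_measureReal]
  refine ENNReal.ofReal_le_ofReal (h.trans_eq ?_)
  rw [mul_pow, ← Real.exp_nat_mul]
  congr 2
  ring

theorem sum_fin_two_rev {A : Type*} [AddCommMonoid A] (F : Fin 2 → A) (r : Fin 2) :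
    ∑ s, F s = F r + F r.rev := by
  revert r
  refine Fin.forall_fin_two.2 ⟨Fin.sum_univ_two F, ?_⟩
  rw [Fin.sum_univ_two, add_comm]
  rfl

variable {M N : Fin 2 → ℕ} {Q : Fin 2 → Fin 2 → ℕ}

/-- The codes in which all streams use the same codebook of integer words. -/
def commonCode {n q s : ℕ} (c : Fin s → Fin n → Fin q)
    (dec : ∀ r : Fin 2, (Fin n → Fin (N r) → ℂ) → ∀ (t : Fin 2) (_ : Fin (Q r t)), Fin s)
    (hdec : ∀ r, Measurable (dec r)) : Code N Q n where
  size _ _ _ := s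
  book _ _ _ w k := ((c w k : ℕ) : ℝ)
  dec := dec
  measurable_dec := hdec

theorem exists_abs_le_sum_norm {n : ℕ} (φ : (Fin n → ℂ) →ₗ[ℝ] ℝ) :
    ∃ K : ℝ, 0 ≤ K ∧ ∀ y, |φ y| ≤ ∑ j, K * ‖y j‖ := by
  refine ⟨‖φ.toContinuousLinearMap‖, norm_nonneg _, fun y => ?_⟩
  rw [← Finset.mul_sum]
  refine (φ.toContinuousLinearMap.le_opNorm y).trans ?_
  gcongr
  rw [pi_norm_le_iff_of_nonneg (Finset.sum_nonneg fun _ _ => norm_nonneg _)]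
  exact fun j => Finset.single_le_sum (f := fun j => ‖y j‖) (fun _ _ => norm_nonneg _)
    (Finset.mem_univ j)

/-- A zero-forcing functional applied to the received signal leaves the desired codeword and
noise. -/
theorem zeroForcing_received {n : ℕ} {H : Channel M N} {V : Precoders M Q} {r t : Fin 2}
    {i : Fin (Q r t)} {φ : (Fin (N r) → ℂ) →ₗ[ℝ] ℝ}
    (h₁ : ∀ s : Σ t, Fin (Q r t), φ (H.mat r s.1 *ᵥ V r s.1 s.2) =
      (Pi.single (⟨t, i⟩ : Σ t, Fin (Q r t)) 1 : (Σ t, Fin (Q r t)) → ℝ) s)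
    (h₂ : ∀ t' i', φ (H.mat r t' *ᵥ V r.rev t' i') = 0) (C : Code N Q n) (w : C.Messages)
    (z : Fin n → Fin (N r) → ℂ) (k : Fin n) :
    φ (C.received H V w r z k) = C.book r t i (w r t i) k + φ (z k) := by
  have h3 (t' : Fin 2) : φ (H.mat r t' *ᵥ C.sent V w t' k) =
      ∑ i', C.book r t' i' (w r t' i') k *
        (Pi.single (⟨t, i⟩ : Σ t, Fin (Q r t)) 1 : (Σ t, Fin (Q r t)) → ℝ) ⟨t', i'⟩ := by
    have h4 (r' : Fin 2) : φ (H.mat r t' *ᵥ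
        ∑ i : Fin (Q r' t'), C.book r' t' i (w r' t' i) k • V r' t' i) =
        ∑ i : Fin (Q r' t'), C.book r' t' i (w r' t' i) k * φ (H.mat r t' *ᵥ V r' t' i) := by
      rw [Matrix.mulVec_sum, map_sum]
      exact Finset.sum_congr rfl fun i _ => by rw [Matrix.mulVec_smul, map_smul, smul_eq_mul]
    rw [Code.sent, sum_fin_two_rev _ r, Matrix.mulVec_add, map_add, h4, h4]
    simp only [h₂, mul_zero, Finset.sum_const_zero, add_zero]
    exact Finset.sum_congr rfl fun i' _ => by rw [← h₁ ⟨t', i'⟩]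
  rw [Code.received, map_add, map_sum]
  congr 1
  simp only [h3]
  rw [← Fintype.sum_sigma' (fun (t' : Fin 2) (i' : Fin (Q r t')) => C.book r t' i' (w r t' i') k *
        (Pi.single (⟨t, i⟩ : Σ t, Fin (Q r t)) 1 : (Σ t, Fin (Q r t)) → ℝ) ⟨t', i'⟩),
    Finset.sum_eq_single (⟨t, i⟩ : Σ t, Fin (Q r t))]
  · simp
  · intro s _ hs
    simp [Pi.single_eq_of_ne hs]
  · simp

/-- The sum of all entries of all precoders in absolute value. -/
noncomputable def precoderBound (V : Precoders M Q) : ℝ :=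
  ∑ t, ∑ r, ∑ i : Fin (Q r t), ∑ j, ‖V r t i j‖

theorem precoderBound_nonneg (V : Precoders M Q) : 0 ≤ precoderBound V :=
  Finset.sum_nonneg fun _ _ => Finset.sum_nonneg fun _ _ => Finset.sum_nonneg fun _ _ =>
    Finset.sum_nonneg fun _ _ => norm_nonneg _

theorem sum_norm_sent_sq_le {n : ℕ} (C : Code N Q n) (V : Precoders M Q) (w : C.Messages)
    {A : ℝ} (hA : ∀ r t i k, |C.book r t i (w r t i) k| ≤ A) (hA0 : 0 ≤ A) (t : Fin 2) (k : Fin n) :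
    ∑ j, ‖C.sent V w t k j‖ ^ 2 ≤ (A * precoderBound V) ^ 2 := by
  have h1 (j : Fin (M t)) : ‖C.sent V w t k j‖ ≤ ∑ r, ∑ i : Fin (Q r t), A * ‖V r t i j‖ := by
    rw [Code.sent, Finset.sum_apply]
    refine (norm_sum_le _ _).trans (Finset.sum_le_sum fun r _ => ?_)
    rw [Finset.sum_apply]
    refine (norm_sum_le _ _).trans (Finset.sum_le_sum fun i _ => ?_)
    rw [Pi.smul_apply, norm_smul, Real.norm_eq_abs]
    exact mul_le_mul_of_nonneg_right (hA r t i k) (norm_nonneg _)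
  have h2 : ∑ j, ‖C.sent V w t k j‖ ≤ A * precoderBound V := by
    calc ∑ j, ‖C.sent V w t k j‖ ≤ ∑ j, ∑ r, ∑ i : Fin (Q r t), A * ‖V r t i j‖ :=
          Finset.sum_le_sum fun j _ => h1 j
      _ = A * ∑ r, ∑ i : Fin (Q r t), ∑ j, ‖V r t i j‖ := by
          rw [Finset.sum_comm, Finset.mul_sum]
          refine Finset.sum_congr rfl fun r _ => ?_
          rw [Finset.sum_comm, Finset.mul_sum]
          exact Finset.sum_congr rfl fun i _ => (Finset.mul_sum _ _ _).symm
      _ ≤ A * precoderBound V := by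
          refine mul_le_mul_of_nonneg_left ?_ hA0
          exact Finset.single_le_sum (f := fun t => ∑ r, ∑ i : Fin (Q r t), ∑ j, ‖V r t i j‖)
            (fun _ _ => Finset.sum_nonneg fun _ _ => Finset.sum_nonneg fun _ _ =>
              Finset.sum_nonneg fun _ _ => norm_nonneg _) (Finset.mem_univ t)
  calc ∑ j, ‖C.sent V w t k j‖ ^ 2 ≤ (∑ j, ‖C.sent V w t k j‖) ^ 2 :=
        Finset.sum_sq_le_sq_sum_of_nonneg fun _ _ => norm_nonneg _
    _ ≤ _ := pow_le_pow_left₀ (Finset.sum_nonneg fun _ _ => norm_nonneg _) h2 2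

/-- Codes for a fixed block length: with integer symbols below `q`, minimum distance decoding after
zero forcing fails only if the noise is atypically large. -/
theorem exists_code {H : Channel M N} {V : Precoders M Q}
    {φ : ∀ (r t : Fin 2) (_ : Fin (Q r t)), (Fin (N r) → ℂ) →ₗ[ℝ] ℝ}
    (h₁ : ∀ r t i, ∀ s : Σ t, Fin (Q r t), φ r t i (H.mat r s.1 *ᵥ V r s.1 s.2) =
      (Pi.single (⟨t, i⟩ : Σ t, Fin (Q r t)) 1 : (Σ t, Fin (Q r t)) → ℝ) s)
    (h₂ : ∀ r t i, ∀ t' i', φ r t i (H.mat r t' *ᵥ V r.rev t' i') = 0) {K : ℝ}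
    (hK : ∀ r t i y, |φ r t i y| ≤ ∑ j, K * ‖y j‖) (n d : ℕ) {q : ℕ} (hq : 0 < q) :
    ∃ C : Code N Q n, (∀ r t i, ((q : ℝ) / (2 ^ (2 * d) * intWeight)) ^ n ≤ C.size r t i) ∧
      (∀ r t i w k, |C.book r t i w k| ≤ (q : ℝ) - 1) ∧
      ∀ w r, C.errorProb H V w r ≤
        Code.noiseLaw n (N r) {z | (d : ℝ) * n ≤ ∑ k, ∑ j, K * ‖z k j‖} := by
  -- Distance above `2 * d * n` leaves at most one codeword within `d * n` of the zero-forced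
  -- signal.
  obtain ⟨s, hs, hsize, c, hc⟩ := exists_code_words n (2 * d) hq
  have hmeas (r t : Fin 2) (i : Fin (Q r t)) (m : Fin s) :
      MeasurableSet {y : Fin n → Fin (N r) → ℂ |
        ∑ k, |φ r t i (y k) - ((c m k : ℕ) : ℝ)| ≤ d * n} := by
    have hφ : Continuous (φ r t i) := (φ r t i).continuous_of_finiteDimensional
    refine (isClosed_le ?_ continuous_const).measurableSet
    exact continuous_finsetSum _ fun k _ =>
      ((hφ.comp (continuous_apply k)).sub continuous_const).abs
  choose dec hdecm hdec using fun r t i => exists_measurable_decoder hs (hmeas r t i)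
  refine ⟨commonCode c (fun r y t i => dec r t i y) fun r => measurable_pi_iff.2 fun t =>
    measurable_pi_iff.2 fun i => hdecm r t i, fun _ _ _ => hsize, fun r t i w k => ?_,
    fun w r => measure_mono fun z hz => ?_⟩
  · change |((c w k : ℕ) : ℝ)| ≤ _
    rw [abs_of_nonneg (Nat.cast_nonneg _), le_sub_iff_add_le]
    exact_mod_cast (c w k).2
  -- Outside one noise event all streams are decoded correctly, so no union bound is needed.
  · by_contra hlarge
    rw [Set.mem_ofPred_eq, not_le] at hlarge
    refine hz ?_
    funext t i
    have hnoise : ∑ k, |φ r t i (z k)| ≤ d * n :=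
      (Finset.sum_le_sum fun k _ => hK r t i (z k)).trans hlarge.le
    refine hdec r t i _ _ ?_ fun m hm => ?_
    · rw [Set.mem_ofPred_eq]
      simp only [zeroForcing_received (h₁ r t i) (h₂ r t i)]
      refine (Finset.sum_congr rfl fun k _ => ?_).trans_le hnoise
      change |((c (w r t i) k : ℕ) : ℝ) + φ r t i (z k) - _| = _
      rw [add_sub_cancel_left]
    · rw [Set.mem_ofPred_eq] at hm
      simp only [zeroForcing_received (h₁ r t i) (h₂ r t i)] at hm
      refine hc m (w r t i) ?_
      calc ∑ k, |((c m k : ℕ) : ℝ) - ((c (w r t i) k : ℕ) : ℝ)|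
          ≤ ∑ k, (|((c (w r t i) k : ℕ) : ℝ) + φ r t i (z k) - ((c m k : ℕ) : ℝ)| +
              |φ r t i (z k)|) := by
            refine Finset.sum_le_sum fun k _ => ?_
            rw [abs_sub_comm]
            have := abs_add_le (((c (w r t i) k : ℕ) : ℝ) + φ r t i (z k) - ((c m k : ℕ) : ℝ))
              (-φ r t i (z k))
            rw [abs_neg] at this
            refine le_of_eq_of_le (congrArg _ ?_) this
            ring
        _ ≤ d * n + d * n := by
            rw [Finset.sum_add_distrib]
            exact add_le_add hm hnoise
        _ = ((2 * d : ℕ) : ℝ) * n := by push_cast; ring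

/-- With `B` the exponential moment of the noise, this makes the Chernoff bound at most `2 ^ (-n)`,
with `d` independent of power and block length. -/
theorem exists_noise_threshold (N : Fin 2 → ℕ) (B : ℝ) :
    ∃ d : ℕ, ∀ r, Real.exp (-(d : ℝ)) * B ^ N r ≤ 1 / 2 := by
  have h (r : Fin 2) : ∀ᶠ d : ℕ in atTop, Real.exp (-(d : ℝ)) * B ^ N r ≤ 1 / 2 := by
    have h1 : Tendsto (fun d : ℕ => Real.exp (-(d : ℝ)) * B ^ N r) atTop (𝓝 (0 * B ^ N r)) :=
      (Real.tendsto_exp_neg_atTop_nhds_zero.comp tendsto_natCast_atTop_atTop).mul_const _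
    rw [zero_mul] at h1
    exact h1.eventually_le_const (by norm_num)
  exact (eventually_all.2 h).exists

theorem tendsto_logb_mul_sqrt_div_logb {c : ℝ} (hc : 0 < c) :
    Tendsto (fun ρ : ℝ => Real.logb 2 (c * √ρ) / Real.logb 2 ρ) atTop (𝓝 (1 / 2)) := by
  have hlog : Tendsto (Real.logb 2) atTop atTop := Real.tendsto_logb_atTop one_lt_two
  have h1 : Tendsto (fun ρ : ℝ => Real.logb 2 c / Real.logb 2 ρ + 1 / 2) atTop (𝓝 (0 + 1 / 2)) :=
    (hlog.const_div_atTop _).add_const _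
  rw [zero_add] at h1
  refine h1.congr' ?_
  filter_upwards [eventually_gt_atTop 0, hlog.eventually_gt_atTop 0] with ρ hρ hl
  have h2 : Real.logb 2 √ρ = Real.logb 2 ρ / 2 := by
    rw [Real.logb, Real.logb, Real.log_sqrt hρ.le]
    ring
  rw [Real.logb_mul hc.ne' (Real.sqrt_pos.2 hρ).ne', h2]
  field_simp

/-- Every stream of an alignment scheme achieves `1 / 2` degree of freedom. -/
theorem IsAlignmentScheme.doFAchievable {H : Channel M N} {V : Precoders M Q} {a : Fin 2 → ℕ}
    (h : IsAlignmentScheme H V a) : DoFAchievable H V fun _ _ _ => 1 / 2 := by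
  choose φ h₁ h₂ using h.exists_zeroForcing
  choose K₀ hK₀ hK₀' using fun r t i => exists_abs_le_sum_norm (φ r t i)
  let K := ∑ r, ∑ t, ∑ i : Fin (Q r t), K₀ r t i
  have hK0 : 0 ≤ K := Finset.sum_nonneg fun r _ => Finset.sum_nonneg fun t _ =>
    Finset.sum_nonneg fun i _ => hK₀ r t i
  have hKle (r t) (i : Fin (Q r t)) : K₀ r t i ≤ K := by
    calc K₀ r t i ≤ ∑ i : Fin (Q r t), K₀ r t i :=
          Finset.single_le_sum (f := fun i => K₀ r t i) (fun i _ => hK₀ r t i) (Finset.mem_univ i)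
      _ ≤ ∑ t, ∑ i : Fin (Q r t), K₀ r t i :=
          Finset.single_le_sum (f := fun t => ∑ i : Fin (Q r t), K₀ r t i)
            (fun t _ => Finset.sum_nonneg fun i _ => hK₀ r t i) (Finset.mem_univ t)
      _ ≤ K := Finset.single_le_sum (f := fun r => ∑ t, ∑ i : Fin (Q r t), K₀ r t i)
            (fun r _ => Finset.sum_nonneg fun t _ => Finset.sum_nonneg fun i _ => hK₀ r t i)
            (Finset.mem_univ r)
  have hK (r t i y) : |φ r t i y| ≤ ∑ j, K * ‖y j‖ :=
    (hK₀' r t i y).trans (Finset.sum_le_sum fun j _ =>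
      mul_le_mul_of_nonneg_right (hKle r t i) (norm_nonneg _))
  obtain ⟨d, hd⟩ := exists_noise_threshold N (∫ z, Real.exp (K * ‖z‖) ∂(complexGaussian 0 1))
  -- Symbols of size at most `c * √ρ` then respect the power constraint; the `+ 1` keeps the
  -- denominator positive.
  let c := 1 / (precoderBound V + 1)
  have hb := precoderBound_nonneg V
  have hc : 0 < c := by positivity
  let D := 2 ^ (2 * d) * intWeight
  have hD : 0 < D := mul_pos (by positivity) intWeight_pos
  refine ⟨fun ρ _ _ _ => Real.logb 2 (c / D * √ρ), fun ρ hρ ε hε => ?_,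
    fun r t i => tendsto_logb_mul_sqrt_div_logb (div_pos hc hD)⟩
  have hsq : 0 < √ρ := Real.sqrt_pos.2 hρ
  have hε' : ∀ᶠ n : ℕ in atTop, ((1 : ℝ) / 2) ^ n ≤ ε :=
    (tendsto_pow_atTop_nhds_zero_of_lt_one (by norm_num) (by norm_num)).eventually_le_const hε
  filter_upwards [hε'] with n hn
  -- With `q = ⌊c * √ρ⌋₊ + 1` levels, the largest symbol is at most `c * √ρ`, yet `q` is at least `c
  -- * √ρ`.
  obtain ⟨C, hsize, hbook, herr⟩ := exists_code h₁ h₂ hK n d (Nat.succ_pos ⌊c * √ρ⌋₊)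
  have hfloor : ((⌊c * √ρ⌋₊ : ℕ) : ℝ) ≤ c * √ρ := Nat.floor_le (by positivity)
  refine ⟨C, fun r t i => le_trans ?_ (hsize r t i), fun w t => ?_, fun w r => ?_⟩
  · rw [mul_comm, Real.rpow_mul zero_le_two, Real.rpow_logb two_pos (by norm_num) (by positivity),
      Real.rpow_natCast]
    refine pow_le_pow_left₀ (by positivity) ?_ n
    rw [div_mul_eq_mul_div]
    refine div_le_div_of_nonneg_right ?_ hD.le
    push_cast
    exact (Nat.lt_floor_add_one _).le
  · have h3 (k : Fin n) : ∑ j, ‖C.sent V w t k j‖ ^ 2 ≤ ρ := by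
      refine (sum_norm_sent_sq_le C V w (A := c * √ρ) (fun r t i k => (hbook r t i _ k).trans ?_)
        (by positivity) t k).trans ?_
      · push_cast
        linarith
      · have h4 : c * precoderBound V ≤ 1 := by
          rw [one_div_mul_eq_div, div_le_one (by positivity)]
          linarith
        calc (c * √ρ * precoderBound V) ^ 2 = (c * precoderBound V) ^ 2 * ρ := by
              rw [mul_right_comm, mul_pow, Real.sq_sqrt hρ.le]
          _ ≤ 1 * ρ := by
              gcongr
              exact pow_le_one₀ (by positivity) h4
          _ = ρ := one_mul ρ
    calc ∑ k, ∑ j, ‖C.sent V w t k j‖ ^ 2 ≤ ∑ _k : Fin n, ρ := Finset.sum_le_sum fun k _ => h3 k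
      _ = n * ρ := by simp
  · refine (herr w r).trans ((noiseLaw_norm_le n (N r) hK0).trans (ENNReal.ofReal_le_ofReal ?_))
    refine le_trans (pow_le_pow_left₀ ?_ (hd r) n) hn
    exact mul_nonneg (Real.exp_pos _).le (pow_nonneg (integral_nonneg fun _ => (Real.exp_pos _).le) _)

theorem totalDoF_half (Q : Fin 2 → Fin 2 → ℕ) :
    totalDoF (Q := Q) (fun _ _ _ => 1 / 2) =
      ((Q 0 0 : ℝ) + Q 0 1 + Q 1 0 + Q 1 1) / 2 := by
  simp only [totalDoF, Fin.sum_univ_two, Finset.sum_const, Finset.card_univ, Fintype.card_fin,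
    nsmul_eq_mul]
  ring

end MIMOX

/-! ### Assembly and arithmetic of the stream counts -/

theorem theorem6 (M N : Fin 2 → ℕ) (x : ℤ)
    (hN : N 1 ≤ N 0) (hNM : M 0 ≤ N 1) (hM : M 1 ≤ M 0) (hC : N 0 + N 1 ≤ 3 * M 1)
    (hx : x = 3 * (M 1 : ℤ) - N 0 - N 1) :
    ∃ Q : Fin 2 → Fin 2 → ℕ,
      -- lengths of the message blocks
      ((Q 0 0 : ℤ) = 2 * ((N 0 : ℤ) - M 1) + ⌊(2 * x / 3 : ℚ)⌋ ∧
        (Q 0 1 : ℤ) = 2 * ((N 0 : ℤ) - M 1) + ⌊(2 * x / 3 : ℚ)⌋ ∧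
        (Q 1 0 : ℤ) = (N 1 : ℤ) + M 1 - N 0 - ⌈((x - 1) / 3 : ℚ)⌉ ∧
        (Q 1 1 : ℤ) = (N 1 : ℤ) + M 1 - N 0 - ⌊(x / 3 : ℚ)⌋) ∧
      -- all four messages are present, outside the degenerate configurations
      (1 < M 0 → N 0 + N 1 ≠ 2 * M 0 + M 1 → ∀ r t, 0 < Q r t) ∧
      -- every stream of the alignment scheme achieves `1 / 2` degree of freedom
      (∀ (m : Fin 2 → Fin 2 → ℂ) (v : Fin 2 → Fin 2 → ℝ≥0), (∀ r t, v r t ≠ 0) →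
        ∀ᵐ H ∂(MIMOX.channelLaw M N m v), ∃ V : MIMOX.Precoders M Q,
          MIMOX.IsAlignmentScheme H V (fun r => min (Q r 0) (Q r 1)) ∧
          MIMOX.DoFAchievable H V (fun _ _ _ => 1 / 2)) ∧
      -- the total
      MIMOX.totalDoF (Q := Q) (fun _ _ _ => 1 / 2)
        = (N 0 : ℝ) + N 1 - M 1 + 1 / 2 * (⌊(2 * x / 3 : ℚ)⌋ : ℝ) ∧
      (x % 3 = 0 → MIMOX.totalDoF (Q := Q) (fun _ _ _ => 1 / 2)
        = 2 * ((N 0 : ℝ) + N 1) / 3) ∧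
      (x % 3 = 1 → MIMOX.totalDoF (Q := Q) (fun _ _ _ => 1 / 2)
        = (2 * ((N 0 : ℝ) + N 1) - 1) / 3) ∧
      (x % 3 = 2 → MIMOX.totalDoF (Q := Q) (fun _ _ _ => 1 / 2)
        = (4 * ((N 0 : ℝ) + N 1) - 1) / 6) := by
  obtain ⟨y, hy⟩ : ∃ y : ℕ, x = y := Int.eq_ofNat_of_zero_le (by omega)
  have hf : ⌊(2 * x / 3 : ℚ)⌋ = 2 * x / 3 := by
    have := Rat.floor_intCast_div_natCast (2 * x) 3
    push_cast at this
    exact this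
  have hf' : ⌊(x / 3 : ℚ)⌋ = x / 3 := by
    have := Rat.floor_intCast_div_natCast x 3
    push_cast at this
    exact this
  have hc : ⌈((x - 1) / 3 : ℚ)⌉ = (x + 1) / 3 := by
    have := Rat.ceil_intCast_div_natCast (x - 1) 3
    push_cast at this
    rw [this]
    omega
  have hcast : ((⌊(2 * x / 3 : ℚ)⌋ : ℤ) : ℝ) = ((2 * y / 3 : ℕ) : ℝ) := by
    rw [hf, hy]
    norm_cast
  have hscheme := MIMOX.exists_hasScheme (m₀ := M 0) (m₁ := M 1) (n₀ := N 0) (n₁ := N 1) (x := y)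
    (by omega) hN hM (by omega)
  generalize ha : 2 * (N 0 - M 1) + 2 * y / 3 = a at hscheme
  generalize hb : N 1 + M 1 - N 0 - (y + 1) / 3 = b at hscheme
  generalize he : (y + 1) / 3 - y / 3 = e at hscheme
  have htotal : MIMOX.totalDoF (Q := MIMOX.blockLength a b e) (fun _ _ _ => 1 / 2) =
      ((a : ℝ) + a + b + (b + e : ℕ)) / 2 := MIMOX.totalDoF_half _
  refine ⟨MIMOX.blockLength a b e, ⟨?_, ?_, ?_, ?_⟩, fun h1 h2 => ?_, fun m v hv => ?_, ?_,
    fun hx3 => ?_, fun hx3 => ?_, fun hx3 => ?_⟩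
  · rw [hf]
    change (a : ℤ) = _
    omega
  · rw [hf]
    change (a : ℤ) = _
    omega
  · rw [hc]
    change (b : ℤ) = _
    omega
  · rw [hf']
    change ((b + e : ℕ) : ℤ) = _
    omega
  -- `a = 0` forces `N 0 = M 1` and `y ≤ 1`; then all antenna numbers equal `y`, against `1 < M 0`.
  -- `b = 0` forces `N 1 = M 1` and `y = 0`, hence `M 0 = M 1` and `N 0 + N 1 = 2 * M 0 + M 1`.
  · refine Fin.forall_fin_two.2 ⟨Fin.forall_fin_two.2 ⟨?_, ?_⟩, Fin.forall_fin_two.2 ⟨?_, ?_⟩⟩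
    · change 0 < a
      omega
    · change 0 < a
      omega
    · change 0 < b
      omega
    · change 0 < b + e
      omega
  · filter_upwards [MIMOX.ae_exists_isScheme hscheme m hv] with H ⟨u₀, u₁, w₀, w₁, f, h⟩
    exact ⟨_, h.isAlignmentScheme, h.isAlignmentScheme.doFAchievable⟩
  · rw [htotal, hcast]
    have h : a + a + b + (b + e) + 2 * M 1 = 2 * N 0 + 2 * N 1 + 2 * y / 3 := by omega
    have h' : (a : ℝ) + a + b + (b + e : ℕ) + 2 * M 1 = 2 * N 0 + 2 * N 1 + (2 * y / 3 : ℕ) := by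
      exact_mod_cast h
    linarith
  · rw [htotal]
    have h : 3 * (a + a + b + (b + e)) = 4 * (N 0 + N 1) := by omega
    have h' : 3 * ((a : ℝ) + a + b + (b + e : ℕ)) = 4 * (N 0 + N 1) := by exact_mod_cast h
    linarith
  · rw [htotal]
    have h : 3 * (a + a + b + (b + e)) + 2 = 4 * (N 0 + N 1) := by omega
    have h' : 3 * ((a : ℝ) + a + b + (b + e : ℕ)) + 2 = 4 * (N 0 + N 1) := by exact_mod_cast h
    linarith
  · rw [htotal]
    have h : 3 * (a + a + b + (b + e)) + 1 = 4 * (N 0 + N 1) := by omega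
    have h' : 3 * ((a : ℝ) + a + b + (b + e : ℕ)) + 1 = 4 * (N 0 + N 1) := by exact_mod_cast h
    linarith
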